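/- **Conventions.** Let $N$ be a lattice of rank $3$, $N_{\mathbb R}=N\otimes\mathbb R$, $M=\mathrm{Hom}(N,\mathbb Z)$, $M_{\mathbb R}=M\otimes\mathbb R$. A (three-dimensional) *reflexive polytope* $\Delta\subset N_{\mathbb R}$ is a lattice polytope with the origin in its interior whose dual $\Delta^*=\{m\in M_{\mathbb R} : \langle m,n\rangle\ge -1\ \text{for all } n\in\Delta\}$ is also a lattice polytope. $\Sigma(\Delta)$ denotes the fan of cones over the proper faces of $\Delta$ (the empty face giving the cone $\{0\}$). A fan $\Sigma'$ is a *refinement* (or *subdivision*) of a fan $\Sigma$ if $\Sigma'$ and $\Sigma$ have the same support and every cone of $\Sigma'$ is contained in a cone of $\Sigma$ (so that $\mathrm{id}_N$ is a map of fans $\Sigma'\to\Sigma$). A complete fan is *projective* if there is a convex function $\varphi:N_{\mathbb R}\to\mathbb R$ such that for every maximal cone $\sigma$ there is $m_\sigma\in M$ with $\varphi=m_\sigma$ on $\sigma$ and $\varphi>m_\sigma$ outside $\sigma$. An *MPCP subdivision* of $\Sigma(\Delta)$ is a fan $\widehat\Sigma(\Delta)$ (of strongly convex rational polyhedral cones)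 subdividing $\Sigma(\Delta)$ such that 1. $\widehat\Sigma(\Delta)$ is projective; 2. every maximal cone of $\widehat\Sigma(\Delta)$ is the simplicial cone over an elementary simplex, i.e. a simplex whose vertices are the primitive lattice generators of the rays of the cone and which contains no lattice points other than its vertices; 3. the primitive lattice generator of every ray of $\widehat\Sigma(\Delta)$ lies in the boundary of $\Delta$. **Theorem.** Let $\Delta_1\subseteq\Delta_2$ be three-dimensional reflexive polytopes in $N_{\mathbb R}$ (with respect to the same lattice $N$), and let $\widehat\Sigma(\Delta_1)$ be any MPCP subdivision of $\Sigma(\Delta_1)$. Then there exists an MPCP subdivision $\widehat\Sigma(\Delta_2)$ of $\Sigma(\Delta_2)$ such that $\widehat\Sigma(\Delta_2)$ is a refinement of $\widehat\Sigma(\Delta_1)$. -/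

import Mathlib

namespace Toric

section LatticePolytopes

variable {V : Type*} [AddCommGroup V] [Module ℝ V]

/-- The dual lattice `M = Hom(N, ℤ)`, viewed inside the dual vector space `M_ℝ`: the linear forms
on `N_ℝ = V` which take integral values on the lattice `N`. -/
def dualLattice (N : Submodule ℤ V) : Submodule ℤ (Module.Dual ℝ V) where
  carrier := {m | ∀ v ∈ N, ∃ k : ℤ, m v = k}
  zero_mem' := fun _ _ => ⟨0, by simp⟩
  add_mem' := by
    intro a b ha hb v hv
    obtain ⟨k, hk⟩ := ha v hv
    obtain ⟨l, hl⟩ := hb v hv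
    exact ⟨k + l, by simp [hk, hl]⟩
  smul_mem' := by
    intro c a ha v hv
    obtain ⟨k, hk⟩ := ha v hv
    exact ⟨c * k, by simp [hk]⟩

/-- A lattice polytope: the convex hull of finitely many lattice points. -/
def IsLatticePolytope (N : Submodule ℤ V) (P : Set V) : Prop :=
  ∃ S : Finset V, (∀ v ∈ S, v ∈ N) ∧ P = convexHull ℝ (S : Set V)

/-- The dual polytope `Δ* = {m ∈ M_ℝ | ⟨m, n⟩ ≥ -1 for all n ∈ Δ}`. -/
def dualPolytope (P : Set V) : Set (Module.Dual ℝ V) :=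
  {m | ∀ n ∈ P, -1 ≤ m n}

/-- `v` is a primitive lattice vector: a nonzero lattice vector which is not a proper multiple
of another lattice vector. -/
def IsPrimitive (N : Submodule ℤ V) (v : V) : Prop :=
  v ∈ N ∧ v ≠ 0 ∧ ∀ (k : ℕ), ∀ w ∈ N, v = k • w → k = 1

/-- The cone `ℝ_{≥0} S` over a set `S`, as a pointed cone: the smallest convex cone that contains
`S` and the origin. See `mem_coneOver` for convex `S`; the cone over `∅` is `{0}`. -/
def coneOver (S : Set V) : PointedCone ℝ V := PointedCone.hull ℝ S

/-- For a nonempty convex set `S`, the cone over `S` is `{r s | r ≥ 0, s ∈ S}`. -/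
theorem mem_coneOver {S : Set V} (hS : Convex ℝ S) (hne : S.Nonempty) (x : V) :
    x ∈ coneOver S ↔ ∃ r : ℝ, 0 ≤ r ∧ ∃ s ∈ S, x = r • s := by
  constructor
  · intro hx
    refine Submodule.span_induction (p := fun x _ => ∃ r : ℝ, 0 ≤ r ∧ ∃ s ∈ S, x = r • s)
      ?_ ?_ ?_ ?_ hx
    · intro y hy
      exact ⟨1, zero_le_one, y, hy, by simp⟩
    · obtain ⟨s, hs⟩ := hne
      exact ⟨0, le_rfl, s, hs, by simp⟩
    · rintro y z - - ⟨r, hr, s, hs, rfl⟩ ⟨t, ht, u, hu, rfl⟩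
      rcases eq_or_lt_of_le (add_nonneg hr ht) with h | h
      · have hr0 : r = 0 := by linarith
        have ht0 : t = 0 := by linarith
        exact ⟨0, le_rfl, s, hs, by simp [hr0, ht0]⟩
      · refine ⟨r + t, h.le, (r / (r + t)) • s + (t / (r + t)) • u,
          hS hs hu (div_nonneg hr h.le) (div_nonneg ht h.le) (by field_simp), ?_⟩
        rw [smul_add, smul_smul, smul_smul, mul_div_cancel₀ _ h.ne', mul_div_cancel₀ _ h.ne']
    · rintro a y - ⟨r, hr, s, hs, rfl⟩
      exact ⟨(a : ℝ) * r, mul_nonneg a.2 hr, s, hs, by rw [mul_smul]; rfl⟩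
  · rintro ⟨r, hr, s, hs, rfl⟩
    exact (coneOver S).smul_mem hr (Submodule.subset_span hs)

end LatticePolytopes

section Fans

variable {V : Type*} [AddCommGroup V] [Module ℝ V]

/-- A strongly convex rational polyhedral cone. -/
def IsRationalCone (N : Submodule ℤ V) (σ : PointedCone ℝ V) : Prop :=
  (∃ S : Finset V, (∀ v ∈ S, v ∈ N) ∧ σ = PointedCone.hull ℝ (S : Set V)) ∧
    (σ : ConvexCone ℝ V).Salient

/-- A fan: a finite collection of strongly convex rational polyhedral cones which contains the
faces of its cones and in which any two cones meet along a common face. -/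
structure IsFan (N : Submodule ℤ V) (F : Set (PointedCone ℝ V)) : Prop where
  finite : F.Finite
  rational : ∀ σ ∈ F, IsRationalCone N σ
  face_mem : ∀ σ ∈ F, ∀ τ : PointedCone ℝ V, τ.IsFaceOf σ → τ ∈ F
  inter_face : ∀ σ ∈ F, ∀ τ ∈ F, (σ ⊓ τ).IsFaceOf σ ∧ (σ ⊓ τ).IsFaceOf τ

/-- The support of a fan: the union of its cones. -/
def fanSupport (F : Set (PointedCone ℝ V)) : Set V :=
  ⋃ σ ∈ F, (σ : Set V)

/-- `F'` is a refinement (subdivision) of `F`: the two fans have the same support and every cone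
of `F'` lies in a cone of `F`. In particular the identity is a map of fans from `F'` to `F`. -/
def Refines (F' F : Set (PointedCone ℝ V)) : Prop :=
  fanSupport F' = fanSupport F ∧ ∀ σ' ∈ F', ∃ σ ∈ F, σ' ≤ σ

/-- The maximal cones of a fan. -/
def IsMaximalCone (F : Set (PointedCone ℝ V)) (σ : PointedCone ℝ V) : Prop :=
  Maximal (fun τ => τ ∈ F) σ

/-- A projective fan: a complete fan with a strictly lower convex integral piecewise linear
function, i.e. a convex function `φ` that agrees with an integral linear form on each maximal
cone, and is strictly larger than this linear form outside the cone. -/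
def IsProjectiveFan (N : Submodule ℤ V) (F : Set (PointedCone ℝ V)) : Prop :=
  fanSupport F = Set.univ ∧
    ∃ φ : V → ℝ, ConvexOn ℝ Set.univ φ ∧
      ∀ σ, IsMaximalCone F σ → ∃ m ∈ dualLattice N,
        (∀ x ∈ σ, φ x = m x) ∧ ∀ x, x ∉ σ → m x < φ x

/-- `σ` is the (simplicial) cone over an elementary lattice simplex, i.e. a simplex without lattice
points other than its vertices. The vertices of the simplex are the primitive generators of the
rays of `σ`. -/
def IsConeOverElementarySimplex (N : Submodule ℤ V) (σ : PointedCone ℝ V) : Prop :=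
  ∃ s : Finset V, (∀ v ∈ s, IsPrimitive N v) ∧
    LinearIndependent ℝ (fun v : s => (v : V)) ∧
    σ = coneOver (convexHull ℝ (s : Set V)) ∧
    ∀ x ∈ convexHull ℝ (s : Set V), x ∈ N → x ∈ s

end Fans

section Reflexive

variable {V : Type*} [NormedAddCommGroup V] [NormedSpace ℝ V]

/-- A reflexive polytope: a lattice polytope with the origin in its interior, whose dual polytope
is a lattice polytope as well. -/
structure IsReflexive (N : Submodule ℤ V) (P : Set V) : Prop where
  lattice : IsLatticePolytope N P
  zero_mem_interior : (0 : V) ∈ interior P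
  dual_lattice : IsLatticePolytope (dualLattice N) (dualPolytope P)

/-- The fan `Σ(Δ)`: the cones over the proper faces of `Δ`. The empty face, which is allowed by
`IsExposed`, gives the cone `{0}`. -/
def faceFan (P : Set V) : Set (PointedCone ℝ V) :=
  {σ | ∃ f : Set V, IsExposed ℝ P f ∧ f ≠ P ∧ σ = coneOver f}

/-- An MPCP subdivision of `Σ(Δ)`: a projective fan `F` subdividing `Σ(Δ)`, such that the maximal
cones of `F` are cones over elementary simplices and the primitive generators of the rays of `F`
lie in the boundary of `Δ`. -/
structure IsMPCP (N : Submodule ℤ V) (P : Set V) (F : Set (PointedCone ℝ V)) : Prop where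
  isFan : IsFan N F
  refines : Refines F (faceFan P)
  projective : IsProjectiveFan N F
  elementary : ∀ σ, IsMaximalCone F σ → IsConeOverElementarySimplex N σ
  ray_mem : ∀ v, IsPrimitive N v → coneOver {v} ∈ F → v ∈ frontier P

end Reflexive

end Toric

namespace Toric

/-! ### Lattice bases, their coordinates and the cones they span -/

section Frames

variable {V : Type*} [AddCommGroup V] [Module ℝ V]

/-! In dimension three, every maximal cone of an MPCP subdivision is spanned by a lattice basis. Its
generators are boundary points of `P₁` in the cone over a proper face, so some integral form equals
one on all of them, and an elementary triangle at height one generates the lattice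
(`span_eq_of_elementary`). Hence the given fan is a regular unimodular triangulation `T₁`, whose
vertices lie in `P₁ ⊆ P₂`.

Whenever the sum of at least two vertices of a simplex lies in `P₂`, take the star subdivision at
this sum. Lattice bases stay lattice bases, the new fan refines the old one, and regularity survives
after the old heights are scaled and the new vertex is pulled slightly below the old piecewise
linear function (`starSubdivision_regular`). Each step adds a lattice point of `P₂` as a vertex, so
the process stops (`exists_refinement`).

It remains to see that the final simplices `{u, v, w}` lie in facets of `P₂`
(`IsReflexive.exists_facet`). The polytope is given by inequalities `ℓ ≤ 1` with integral `ℓ`, so a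
sum of two vertices outside `P₂` forces the two onto a common facet. If no facet contains all three,
then `(u + v + w) / 2` lies in `P₂`, while `u + v + w` does not; the latter gives a form with values
`(1, 1, 0)` up to order. The facet of this form contains `(u + v + w) / 2`, yet the forms of the
other two pairs and integrality keep its lattice points, hence the whole facet, in a half-space that
misses this point.

Thus the final fan refines the face fan of `P₂`, and its rays are generated by nonzero lattice
points of `P₂`, which lie on the boundary by reflexivity. -/

theorem mem_hull_finset {s : Finset V} {v : V} :
    v ∈ PointedCone.hull ℝ (s : Set V) ↔
      ∃ c : V → ℝ, (∀ a ∈ s, 0 ≤ c a) ∧ ∑ a ∈ s, c a • a = v := by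
  constructor
  · intro h
    obtain ⟨f, -, hf⟩ := Submodule.mem_span_finset.1 h
    exact ⟨fun a => f a, fun a _ => (f a).2, hf⟩
  · rintro ⟨c, hc, rfl⟩
    exact Submodule.sum_mem _ fun a ha =>
      PointedCone.smul_mem _ (hc a ha) (Submodule.subset_span ha)

theorem coneOver_convexHull (s : Set V) : coneOver (convexHull ℝ s) = PointedCone.hull ℝ s := by
  apply le_antisymm
  · refine Submodule.span_le.2 (convexHull_min Submodule.subset_span ?_)
    exact PointedCone.convex _
  · exact Submodule.span_mono (subset_convexHull ℝ s)

/-- A dual integral form that is smaller at a lattice point is smaller by at least one. -/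
theorem dualLattice_le_sub_one {N : Submodule ℤ V} {m m' : Module.Dual ℝ V}
    (hm : m ∈ dualLattice N) (hm' : m' ∈ dualLattice N) {v : V} (hv : v ∈ N) (h : m v < m' v) :
    m v ≤ m' v - 1 := by
  obtain ⟨k, hk⟩ := hm v hv
  obtain ⟨l, hl⟩ := hm' v hv
  rw [hk, hl] at h ⊢
  have : k + 1 ≤ l := by exact_mod_cast h
  have : (k : ℝ) + 1 ≤ l := by exact_mod_cast this
  linarith

/-- The finite set `s` is a `ℤ`-basis of the lattice `N`, and the forms `x a` are the coordinates
with respect to it. -/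
structure IsFrame (N : Submodule ℤ V) (s : Finset V) (x : V → Module.Dual ℝ V) : Prop where
  mem : ∀ a ∈ s, a ∈ N
  dual : ∀ a ∈ s, x a ∈ dualLattice N
  self : ∀ a ∈ s, x a a = 1
  ne : ∀ a ∈ s, ∀ b ∈ s, b ≠ a → x a b = 0
  expand : ∀ v, ∑ a ∈ s, x a v • a = v

namespace IsFrame

variable {N : Submodule ℤ V} {s : Finset V} {x : V → Module.Dual ℝ V}

theorem coord_sum (h : IsFrame N s x) {A : Finset V} (hA : A ⊆ s) (c : V → ℝ) {a : V}
    (ha : a ∈ A) : x a (∑ b ∈ A, c b • b) = c a := by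
  rw [map_sum, Finset.sum_eq_single a]
  · simp [h.self a (hA ha)]
  · intro b hb hba
    simp [h.ne a (hA ha) b (hA hb) hba]
  · exact fun h' => (h' ha).elim

theorem coord_sum_notMem (h : IsFrame N s x) {A : Finset V} (hA : A ⊆ s) (c : V → ℝ) {a : V}
    (has : a ∈ s) (ha : a ∉ A) : x a (∑ b ∈ A, c b • b) = 0 := by
  rw [map_sum]
  refine Finset.sum_eq_zero fun b hb => ?_
  have : b ≠ a := by rintro rfl; exact ha hb
  simp [h.ne a has b (hA hb) this]

theorem apply_eq (h : IsFrame N s x) (m : Module.Dual ℝ V) (v : V) :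
    m v = ∑ a ∈ s, x a v * m a := by
  conv_lhs => rw [← h.expand v]
  simp

theorem mem_hull (h : IsFrame N s x) {A : Finset V} (hA : A ⊆ s) {v : V} :
    v ∈ PointedCone.hull ℝ (A : Set V) ↔
      (∀ a ∈ s, 0 ≤ x a v) ∧ ∀ a ∈ s, a ∉ A → x a v = 0 := by
  constructor
  · intro hv
    obtain ⟨c, hc, rfl⟩ := mem_hull_finset.1 hv
    refine ⟨fun a ha => ?_, fun a ha haA => h.coord_sum_notMem hA c ha haA⟩
    by_cases haA : a ∈ A
    · rw [h.coord_sum hA c haA]; exact hc a haA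
    · rw [h.coord_sum_notMem hA c ha haA]
  · rintro ⟨h0, h1⟩
    refine mem_hull_finset.2 ⟨fun a => x a v, fun a ha => h0 a (hA ha), ?_⟩
    rw [Finset.sum_subset hA, h.expand]
    intro a ha haA
    simp [h1 a ha haA]

theorem mem_hull_self (h : IsFrame N s x) {v : V} :
    v ∈ PointedCone.hull ℝ (s : Set V) ↔ ∀ a ∈ s, 0 ≤ x a v := by
  rw [h.mem_hull subset_rfl]
  exact ⟨fun h => h.1, fun h => ⟨h, fun a ha ha' => (ha' ha).elim⟩⟩

theorem ne_zero (h : IsFrame N s x) {a : V} (ha : a ∈ s) : a ≠ 0 := by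
  rintro rfl
  simpa using h.self 0 ha

theorem linearIndependent (h : IsFrame N s x) : LinearIndependent ℝ (fun v : s => (v : V)) := by
  classical
  rw [Fintype.linearIndependent_iff]
  intro g hg i
  have : ∀ b : s, x i (b : V) = if b = i then 1 else 0 := by
    intro b
    split_ifs with hb
    · rw [hb]; exact h.self _ i.2
    · exact h.ne _ i.2 _ b.2 fun hb' => hb (Subtype.ext hb')
  simpa [map_sum, this] using congrArg (x i) hg

theorem card_eq (h : IsFrame N s x) : s.card = Module.finrank ℝ V := by
  have hspan : ⊤ ≤ Submodule.span ℝ (Set.range fun v : s => (v : V)) := by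
    intro v _
    rw [← h.expand v]
    exact Submodule.sum_mem _ fun a ha =>
      Submodule.smul_mem _ _ (Submodule.subset_span ⟨⟨a, ha⟩, rfl⟩)
  rw [Module.finrank_eq_card_basis (Module.Basis.mk h.linearIndependent hspan)]
  simp

theorem isPrimitive (h : IsFrame N s x) {a : V} (ha : a ∈ s) : IsPrimitive N a := by
  refine ⟨h.mem a ha, h.ne_zero ha, fun k w hw hk => ?_⟩
  obtain ⟨l, hl⟩ := h.dual a ha w hw
  have h1 := h.self a ha
  have h2 : x a a = k * l := by
    rw [← hl, ← nsmul_eq_mul, ← map_nsmul, ← hk]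
  have : (k : ℤ) * l = 1 := by
    have : (k : ℝ) * l = 1 := by rw [← h2, h1]
    exact_mod_cast this
  have := Int.eq_one_or_neg_one_of_mul_eq_one this
  omega

/-- A primitive vector on the ray spanned by a vector of the frame. -/
theorem eq_of_isPrimitive (h : IsFrame N s x) {a v : V} (ha : a ∈ s) (hv : IsPrimitive N v) {r : ℝ}
    (hr : 0 ≤ r) (hva : v = r • a) : v = a := by
  obtain ⟨k, hk⟩ := h.dual a ha v hv.1
  have hk' : r = k := by rw [← hk, hva]; simp [h.self a ha]
  have hk0 : 0 ≤ k := by rw [hk'] at hr; exact_mod_cast hr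
  lift k to ℕ using hk0
  have : v = k • a := by
    rw [hva, hk']
    simp only [Int.cast_natCast, Nat.cast_smul_eq_nsmul]
  rw [this, hv.2.2 k a (h.mem a ha) this, one_smul]

/-- The barycentric coordinates of a lattice point of the simplex are nonnegative integers with sum
one, so one of them is one and the others vanish. -/
theorem isConeOverElementarySimplex (h : IsFrame N s x) :
    IsConeOverElementarySimplex N (PointedCone.hull ℝ (s : Set V)) := by
  classical
  refine ⟨s, fun v hv => h.isPrimitive hv, h.linearIndependent, (coneOver_convexHull _).symm, ?_⟩
  intro v hv hvN
  obtain ⟨w, hw0, hw1, rfl⟩ := Finset.mem_convexHull'.1 hv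
  obtain ⟨a, ha, hwa⟩ : ∃ a ∈ s, w a ≠ 0 := by
    by_contra! hcon
    rw [Finset.sum_eq_zero hcon] at hw1
    exact zero_ne_one hw1
  have hint : ∀ b ∈ s, ∃ k : ℤ, w b = k := fun b hb => by
    rw [← h.coord_sum subset_rfl w hb]; exact h.dual b hb _ hvN
  have hwa1 : 1 ≤ w a := by
    obtain ⟨k, hk⟩ := hint a ha
    have : 0 < w a := lt_of_le_of_ne (hw0 a ha) hwa.symm
    rw [hk] at this ⊢
    exact_mod_cast this
  have herase := Finset.add_sum_erase s w ha
  have hnn : ∀ b ∈ s.erase a, 0 ≤ w b := fun b hb => hw0 b (Finset.mem_of_mem_erase hb)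
  have hz : ∑ b ∈ s.erase a, w b = 0 :=
    le_antisymm (by linarith) (Finset.sum_nonneg hnn)
  have hz' := (Finset.sum_eq_zero_iff_of_nonneg hnn).1 hz
  have hwa' : w a = 1 := by linarith
  rw [← Finset.add_sum_erase s _ ha, Finset.sum_eq_zero (fun b hb => by rw [hz' b hb, zero_smul]),
    hwa', one_smul, add_zero]
  exact ha

theorem salient (h : IsFrame N s x) {A : Finset V} (hA : A ⊆ s) :
    (PointedCone.hull ℝ (A : Set V) : ConvexCone ℝ V).Salient := by
  intro v hv hv0 hv'
  apply hv0
  rw [PointedCone.mem_toConvexCone, h.mem_hull hA] at hv hv'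
  rw [← h.expand v]
  refine Finset.sum_eq_zero fun a ha => ?_
  have h1 := hv.1 a ha
  have h2 := hv'.1 a ha
  rw [map_neg] at h2
  rw [show x a v = 0 by linarith, zero_smul]

/-- The smaller cone is cut out by the vanishing of coordinates that are nonnegative on the larger
one. -/
theorem isFaceOf (h : IsFrame N s x) {A B : Finset V} (hA : A ⊆ s) (hBA : B ⊆ A) :
    (PointedCone.hull ℝ (B : Set V)).IsFaceOf (PointedCone.hull ℝ (A : Set V)) := by
  refine ⟨Submodule.span_mono (by exact_mod_cast hBA), fun {v w r} hv hw hr hvw => ?_⟩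
  rw [h.mem_hull hA] at hv hw
  rw [h.mem_hull (hBA.trans hA)] at hvw ⊢
  refine ⟨hv.1, fun a ha haB => ?_⟩
  have h1 := hvw.2 a ha haB
  simp only [map_add, map_smul, smul_eq_mul] at h1
  have h2 := hv.1 a ha
  have h3 := hw.1 a ha
  have h4 := mul_nonneg hr.le h2
  have : r * x a v = 0 := by linarith
  exact (mul_eq_zero.1 this).resolve_left hr.ne'

end IsFrame

/-- A vector that occurs with positive coefficient in an element of a face lies in the face. -/
theorem mem_face_of_pos {A : Finset V} {τ : PointedCone ℝ V}
    (hτ : τ.IsFaceOf (PointedCone.hull ℝ (A : Set V))) {c : V → ℝ} (hc : ∀ a ∈ A, 0 ≤ c a)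
    (hv : ∑ a ∈ A, c a • a ∈ τ) {a : V} (ha : a ∈ A) (hca : 0 < c a) : a ∈ τ := by
  classical
  have hmem : ∀ b ∈ A, b ∈ PointedCone.hull ℝ (A : Set V) := fun b hb => Submodule.subset_span hb
  rw [← Finset.add_sum_erase A _ ha] at hv
  refine hτ.mem_of_smul_add_mem (hmem a ha) (Submodule.sum_mem _ fun b hb => ?_) hca hv
  exact PointedCone.smul_mem _ (hc b (Finset.mem_of_mem_erase hb))
    (hmem b (Finset.mem_of_mem_erase hb))

/-- The generators that occur with positive coefficient in an element of a face lie in the face, so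
those in `τ` span it. -/
theorem exists_eq_hull_of_isFaceOf {A : Finset V} {τ : PointedCone ℝ V}
    (hτ : τ.IsFaceOf (PointedCone.hull ℝ (A : Set V))) :
    ∃ B ⊆ A, τ = PointedCone.hull ℝ (B : Set V) := by
  classical
  refine ⟨A.filter (· ∈ τ), Finset.filter_subset _ _, le_antisymm ?_ ?_⟩
  · intro v hv
    obtain ⟨c, hc, rfl⟩ := mem_hull_finset.1 (hτ.le hv)
    refine Submodule.sum_mem _ fun a ha => ?_
    rcases (hc a ha).eq_or_lt with h0 | h0
    · rw [← h0, zero_smul]; exact Submodule.zero_mem _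
    · refine PointedCone.smul_mem _ h0.le (Submodule.subset_span ?_)
      simpa [ha] using mem_face_of_pos hτ hc hv ha h0
  · refine Submodule.span_le.2 fun a ha => ?_
    simp only [Finset.coe_filter] at ha
    exact ha.2

end Frames

/-! ### Regular unimodular triangulations and their fans -/

section Vertices

variable {V : Type*}

/-- The vertices of a triangulation. -/
def vertices (T : Set (Finset V)) : Set V := ⋃ s ∈ T, (s : Set V)

theorem mem_vertices {T : Set (Finset V)} {v : V} : v ∈ vertices T ↔ ∃ s ∈ T, v ∈ s := by
  simp [vertices]

end Vertices

section Triangulations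

variable {V : Type*} [AddCommGroup V] [Module ℝ V]

/-- `m` is the integral linear form of the cone over the simplex `s` for the heights `φ` of the
vertices of `T`: it takes the values `φ` at the vertices of `s`, smaller values at the others. -/
structure IsSupportingForm (N : Submodule ℤ V) (T : Set (Finset V)) (φ : V → ℝ) (s : Finset V)
    (m : Module.Dual ℝ V) : Prop where
  dual : m ∈ dualLattice N
  eq : ∀ r ∈ s, m r = φ r
  le : ∀ t ∈ T, ∀ r ∈ t, m r ≤ φ r
  mem : ∀ t ∈ T, ∀ r ∈ t, m r = φ r → r ∈ s

/-- A regular unimodular triangulation: a finite collection of lattice bases whose cones cover the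
space, with heights `φ` of the vertices which are strictly convex. -/
structure IsTriangulation (N : Submodule ℤ V) (T : Set (Finset V)) : Prop where
  finite : T.Finite
  frame : ∀ s ∈ T, ∃ x, IsFrame N s x
  cover : ∀ v, ∃ s ∈ T, v ∈ PointedCone.hull ℝ (s : Set V)
  regular : ∃ φ : V → ℝ, ∀ s ∈ T, ∃ m, IsSupportingForm N T φ s m

/-- The fan of cones over the faces of the simplices of a triangulation. -/
def triangulationFan (T : Set (Finset V)) : Set (PointedCone ℝ V) :=
  {σ | ∃ s ∈ T, ∃ A ⊆ s, σ = PointedCone.hull ℝ (A : Set V)}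

namespace IsSupportingForm

variable {N : Submodule ℤ V} {T : Set (Finset V)} {φ : V → ℝ} {s t : Finset V}
  {m m' : Module.Dual ℝ V} {y : V → Module.Dual ℝ V}

/-- The inequality at the vertices of `t` extends to nonnegative combinations. So the piecewise
linear extension of `φ` is the maximum of the supporting forms. -/
theorem apply_le (hm : IsSupportingForm N T φ s m) (hm' : IsSupportingForm N T φ t m')
    (ht : t ∈ T) (hy : IsFrame N t y) {v : V} (hv : v ∈ PointedCone.hull ℝ (t : Set V)) :
    m v ≤ m' v := by
  rw [hy.apply_eq m, hy.apply_eq m']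
  refine Finset.sum_le_sum fun r hr => mul_le_mul_of_nonneg_left ?_ (hy.mem_hull_self.1 hv r hr)
  rw [hm'.eq r hr]
  exact hm.le t ht r hr

/-- The difference `m' v - m v` is a sum of nonnegative contributions of the vertices of `t`. If it
vanishes, the forms agree at every vertex that occurs in `v`, and strict convexity puts that vertex
in `s`. -/
theorem mem_of_apply_eq (hm : IsSupportingForm N T φ s m) (hm' : IsSupportingForm N T φ t m')
    (ht : t ∈ T) (hy : IsFrame N t y) {v : V} (hv : v ∈ PointedCone.hull ℝ (t : Set V))
    (h : m v = m' v) {r : V} (hr : r ∈ t) (hrv : y r v ≠ 0) : r ∈ s := by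
  have h0 : ∑ a ∈ t, y a v * (m' a - m a) = 0 := by
    simp only [mul_sub, Finset.sum_sub_distrib]
    rw [← hy.apply_eq m, ← hy.apply_eq m', h, sub_self]
  have hnn : ∀ a ∈ t, 0 ≤ y a v * (m' a - m a) := fun a ha => by
    refine mul_nonneg (hy.mem_hull_self.1 hv a ha) ?_
    rw [hm'.eq a ha]
    exact sub_nonneg.2 (hm.le t ht a ha)
  have h1 := (Finset.sum_eq_zero_iff_of_nonneg hnn).1 h0 r hr
  have h2 := (mul_eq_zero.1 h1).resolve_left hrv
  refine hm.mem t ht r hr ?_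
  rw [← hm'.eq r hr]
  linarith

theorem mem_hull_of_apply_eq (hm : IsSupportingForm N T φ s m) (hm' : IsSupportingForm N T φ t m')
    (ht : t ∈ T) (hy : IsFrame N t y) {v : V} (hv : v ∈ PointedCone.hull ℝ (t : Set V))
    (h : m v = m' v) : v ∈ PointedCone.hull ℝ (s : Set V) := by
  rw [← hy.expand v]
  refine Submodule.sum_mem _ fun r hr => ?_
  by_cases hrv : y r v = 0
  · rw [hrv, zero_smul]; exact Submodule.zero_mem _
  · exact PointedCone.smul_mem _ (hy.mem_hull_self.1 hv r hr)
      (Submodule.subset_span (hm.mem_of_apply_eq hm' ht hy hv h hr hrv))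

end IsSupportingForm

namespace IsTriangulation

variable {N : Submodule ℤ V} {T : Set (Finset V)}

/-- Proper intersection of the simplices is not part of `IsTriangulation`; it follows from
regularity. The two supporting forms bound each other at a common point, so they agree there, and
only shared vertices occur in it. -/
theorem mem_hull_inter [DecidableEq V] (hT : IsTriangulation N T) {s t : Finset V} (hs : s ∈ T)
    (ht : t ∈ T) {A B : Finset V} (hA : A ⊆ s) (hB : B ⊆ t) {v : V}
    (hvA : v ∈ PointedCone.hull ℝ (A : Set V)) (hvB : v ∈ PointedCone.hull ℝ (B : Set V)) :
    v ∈ PointedCone.hull ℝ ((A ∩ B : Finset V) : Set V) := by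
  obtain ⟨φ, hφ⟩ := hT.regular
  obtain ⟨m, hm⟩ := hφ s hs
  obtain ⟨m', hm'⟩ := hφ t ht
  obtain ⟨x, hx⟩ := hT.frame s hs
  obtain ⟨y, hy⟩ := hT.frame t ht
  have hvs : v ∈ PointedCone.hull ℝ (s : Set V) :=
    Submodule.span_mono (Finset.coe_subset.2 hA) hvA
  have hvt : v ∈ PointedCone.hull ℝ (t : Set V) :=
    Submodule.span_mono (Finset.coe_subset.2 hB) hvB
  have heq : m v = m' v := le_antisymm (hm.apply_le hm' ht hy hvt) (hm'.apply_le hm hs hx hvs)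
  have hmem : ∀ r ∈ t, y r v ≠ 0 → r ∈ s := fun r hr hrv =>
    hm.mem_of_apply_eq hm' ht hy hvt heq hr hrv
  have hsum : ∑ b ∈ t ∩ s, y b v • b = v := by
    conv_rhs => rw [← hy.expand v]
    refine Finset.sum_subset Finset.inter_subset_left fun b hb hb' => ?_
    have : y b v = 0 := by
      by_contra h
      exact hb' (Finset.mem_inter.2 ⟨hb, hmem b hb h⟩)
    rw [this, zero_smul]
  refine (hy.mem_hull (Finset.inter_subset_right.trans hB)).2 ⟨hy.mem_hull_self.1 hvt, ?_⟩
  intro r hr hrAB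
  by_contra hrv
  apply hrAB
  rw [Finset.mem_inter]
  constructor
  · by_contra hrA
    have h1 := ((hx.mem_hull hA).1 hvA).2 r (hmem r hr hrv) hrA
    rw [← hsum, hx.coord_sum Finset.inter_subset_right (fun b => y b v)
      (Finset.mem_inter.2 ⟨hr, hmem r hr hrv⟩)] at h1
    exact hrv h1
  · by_contra hrB
    exact hrv (((hy.mem_hull hB).1 hvB).2 r hr hrB)

theorem hull_inf_hull [DecidableEq V] (hT : IsTriangulation N T) {s t : Finset V} (hs : s ∈ T)
    (ht : t ∈ T) {A B : Finset V} (hA : A ⊆ s) (hB : B ⊆ t) :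
    PointedCone.hull ℝ (A : Set V) ⊓ PointedCone.hull ℝ (B : Set V) =
      PointedCone.hull ℝ ((A ∩ B : Finset V) : Set V) := by
  refine le_antisymm (fun v hv => hT.mem_hull_inter hs ht hA hB hv.1 hv.2) (le_inf ?_ ?_)
  · exact Submodule.span_mono (Finset.coe_subset.2 Finset.inter_subset_left)
  · exact Submodule.span_mono (Finset.coe_subset.2 Finset.inter_subset_right)

theorem isFan (hT : IsTriangulation N T) : IsFan N (triangulationFan T) where
  finite := by
    have h : triangulationFan T = ⋃ s ∈ T, (fun A : Finset V => PointedCone.hull ℝ (A : Set V)) ''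
        {A | A ⊆ s} := by
      ext σ
      simp only [triangulationFan, Set.mem_ofPred_eq, Set.mem_iUnion, Set.mem_image, exists_prop,
        eq_comm]
    rw [h]
    refine hT.finite.biUnion fun s _ => Set.Finite.image _ ?_
    exact (Finset.finite_toSet s.powerset).subset fun A hA => by simpa using hA
  rational := by
    rintro σ ⟨s, hs, A, hA, rfl⟩
    obtain ⟨x, hx⟩ := hT.frame s hs
    exact ⟨⟨A, fun v hv => hx.mem v (hA hv), rfl⟩, hx.salient hA⟩
  face_mem := by
    rintro σ ⟨s, hs, A, hA, rfl⟩ τ hτ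
    obtain ⟨B, hB, rfl⟩ := exists_eq_hull_of_isFaceOf hτ
    exact ⟨s, hs, B, hB.trans hA, rfl⟩
  inter_face := by
    classical
    rintro σ ⟨s, hs, A, hA, rfl⟩ τ ⟨t, ht, B, hB, rfl⟩
    obtain ⟨x, hx⟩ := hT.frame s hs
    obtain ⟨y, hy⟩ := hT.frame t ht
    rw [hT.hull_inf_hull hs ht hA hB]
    exact ⟨hx.isFaceOf hA Finset.inter_subset_left, hy.isFaceOf hB Finset.inter_subset_right⟩

theorem fanSupport_eq (hT : IsTriangulation N T) : fanSupport (triangulationFan T) = Set.univ := by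
  refine Set.eq_univ_of_forall fun v => ?_
  obtain ⟨s, hs, hv⟩ := hT.cover v
  exact Set.mem_biUnion (show _ ∈ triangulationFan T from ⟨s, hs, s, subset_rfl, rfl⟩) hv

theorem exists_of_isMaximalCone {σ : PointedCone ℝ V} (hσ : IsMaximalCone (triangulationFan T) σ) :
    ∃ s ∈ T, σ = PointedCone.hull ℝ (s : Set V) := by
  obtain ⟨s, hs, A, hA, rfl⟩ := hσ.prop
  exact ⟨s, hs, hσ.eq_of_le ⟨s, hs, s, subset_rfl, rfl⟩
    (Submodule.span_mono (Finset.coe_subset.2 hA))⟩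

/-- The convex function is the maximum of the supporting forms, evaluated at `v` by the form of a
chosen simplex `S v` whose cone contains `v`. -/
theorem isProjectiveFan (hT : IsTriangulation N T) : IsProjectiveFan N (triangulationFan T) := by
  refine ⟨hT.fanSupport_eq, ?_⟩
  obtain ⟨φ, hφ⟩ := hT.regular
  choose! m hm using hφ
  choose! x hx using hT.frame
  choose S hST hS using hT.cover
  have hle : ∀ s ∈ T, ∀ v, m s v ≤ m (S v) v := fun s hs v =>
    (hm s hs).apply_le (hm _ (hST v)) (hST v) (hx _ (hST v)) (hS v)
  refine ⟨fun v => m (S v) v, ⟨convex_univ, ?_⟩, fun σ hσ => ?_⟩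
  · intro v _ w _ a b ha hb _
    simp only [smul_eq_mul, map_add, map_smul]
    exact add_le_add (mul_le_mul_of_nonneg_left (hle _ (hST _) v) ha)
      (mul_le_mul_of_nonneg_left (hle _ (hST _) w) hb)
  · obtain ⟨s, hs, rfl⟩ := exists_of_isMaximalCone hσ
    refine ⟨m s, (hm s hs).dual, fun v hv => ?_, fun v hv => ?_⟩
    · exact le_antisymm ((hm _ (hST v)).apply_le (hm s hs) hs (hx s hs) hv) (hle s hs v)
    · refine lt_of_le_of_ne (hle s hs v) fun h => hv ?_
      exact (hm s hs).mem_hull_of_apply_eq (hm _ (hST v)) (hST v) (hx _ (hST v)) (hS v) h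

theorem mem_vertices_of_coneOver_mem (hT : IsTriangulation N T) {v : V} (hv : IsPrimitive N v)
    (h : coneOver {v} ∈ triangulationFan T) : v ∈ vertices T := by
  obtain ⟨s, hs, A, hA, hσ⟩ := h
  obtain ⟨x, hx⟩ := hT.frame s hs
  have hσ' : PointedCone.hull ℝ ({v} : Set V) = PointedCone.hull ℝ (A : Set V) := hσ
  have hmem : ∀ w, w ∈ PointedCone.hull ℝ (A : Set V) → ∃ c : ℝ, 0 ≤ c ∧ c • v = w := by
    intro w hw
    rw [← hσ'] at hw
    obtain ⟨c, hc⟩ := Submodule.mem_span_singleton.1 hw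
    exact ⟨c, c.2, hc⟩
  have hvA : v ∈ PointedCone.hull ℝ (A : Set V) := by
    rw [← hσ']
    exact Submodule.subset_span rfl
  obtain ⟨a, ha⟩ : A.Nonempty := by
    rw [Finset.nonempty_iff_ne_empty]
    rintro rfl
    refine hv.2.1 ?_
    simpa using hvA
  obtain ⟨c, hc0, hc⟩ := hmem a (Submodule.subset_span ha)
  have hc0' : c ≠ 0 := by
    rintro rfl
    exact hx.ne_zero (hA ha) (by rw [← hc, zero_smul])
  have : v = a := hx.eq_of_isPrimitive (hA ha) hv (inv_nonneg.2 hc0)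
    (by rw [← hc, inv_smul_smul₀ hc0'])
  rw [this]
  exact mem_vertices.2 ⟨s, hs, hA ha⟩

end IsTriangulation

end Triangulations

/-! ### Star subdivisions -/

section StarSubdivision

variable {V : Type*} [AddCommGroup V]

open Classical in
/-- The star subdivision of a triangulation at the sum of a set `A` of vertices. -/
def starSubdivision (T : Set (Finset V)) (A : Finset V) : Set (Finset V) :=
  {t | (t ∈ T ∧ ¬A ⊆ t) ∨ ∃ s ∈ T, A ⊆ s ∧ ∃ a ∈ A, t = insert (∑ b ∈ A, b) (s.erase a)}

theorem starSubdivision_finite {T : Set (Finset V)} (hT : T.Finite) (A : Finset V) :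
    (starSubdivision T A).Finite := by
  classical
  have h : starSubdivision T A ⊆ T ∪ ⋃ s ∈ T, ((fun a => insert (∑ b ∈ A, b) (s.erase a)) '' A) := by
    rintro t (ht | ⟨s, hs, -, a, ha, rfl⟩)
    · exact Or.inl ht.1
    · refine Or.inr (Set.mem_biUnion hs ⟨a, ha, ?_⟩)
      congr!
  exact (hT.union (hT.biUnion fun s _ => A.finite_toSet.image _)).subset h

theorem vertices_starSubdivision_subset {T : Set (Finset V)} {A : Finset V} :
    vertices (starSubdivision T A) ⊆ insert (∑ b ∈ A, b) (vertices T) := by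
  classical
  intro v hv
  obtain ⟨t, ht, hvt⟩ := mem_vertices.1 hv
  rcases ht with ht | ⟨s, hs, hA, a, ha, rfl⟩
  · exact Or.inr (mem_vertices.2 ⟨t, ht.1, hvt⟩)
  · rcases Finset.mem_insert.1 hvt with rfl | h
    · exact Or.inl rfl
    · exact Or.inr (mem_vertices.2 ⟨s, hs, Finset.mem_of_mem_erase h⟩)

theorem subset_vertices_starSubdivision {T : Set (Finset V)} {s A : Finset V} (hs : s ∈ T) (hA : A ⊆ s)
    (hcard : 1 < A.card) :
    insert (∑ b ∈ A, b) (vertices T) ⊆ vertices (starSubdivision T A) := by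
  classical
  rintro v (rfl | hv)
  · obtain ⟨a, ha⟩ := Finset.card_pos.1 (zero_lt_one.trans hcard)
    exact mem_vertices.2 ⟨_, Or.inr ⟨s, hs, hA, a, ha, rfl⟩, Finset.mem_insert_self _ _⟩
  · obtain ⟨t, ht, hvt⟩ := mem_vertices.1 hv
    by_cases hAt : A ⊆ t
    -- An old vertex survives because the replaced element of `A` can be chosen different from it.
    · obtain ⟨a, ha, hav⟩ := Finset.exists_mem_ne hcard v
      exact mem_vertices.2 ⟨_, Or.inr ⟨t, ht, hAt, a, ha, rfl⟩,
        Finset.mem_insert_of_mem (Finset.mem_erase.2 ⟨hav.symm, hvt⟩)⟩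
    · exact mem_vertices.2 ⟨t, Or.inl ⟨ht, hAt⟩, hvt⟩

end StarSubdivision

section StarSubdivision

variable {V : Type*} [AddCommGroup V] [Module ℝ V]

namespace IsFrame

variable {N : Submodule ℤ V} {s : Finset V} {x : V → Module.Dual ℝ V}

theorem coord_sum_one (h : IsFrame N s x) {A : Finset V} (hA : A ⊆ s) {a : V} (ha : a ∈ A) :
    x a (∑ b ∈ A, b) = 1 := by
  simpa using h.coord_sum hA (fun _ => 1) ha

theorem coord_sum_zero (h : IsFrame N s x) {A : Finset V} (hA : A ⊆ s) {a : V} (has : a ∈ s)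
    (ha : a ∉ A) : x a (∑ b ∈ A, b) = 0 := by
  simpa using h.coord_sum_notMem hA (fun _ => 1) has ha

theorem sum_notMem (h : IsFrame N s x) {A : Finset V} (hA : A ⊆ s) (hcard : 1 < A.card) :
    ∑ b ∈ A, b ∉ s := by
  intro hc
  obtain ⟨a, ha, hac⟩ := Finset.exists_mem_ne hcard (∑ b ∈ A, b)
  have h1 := h.coord_sum_one hA ha
  rw [h.ne a (hA ha) _ hc hac.symm] at h1
  exact zero_ne_one h1

variable [DecidableEq V]

theorem sum_notMem_erase (h : IsFrame N s x) {A : Finset V} (hA : A ⊆ s) {a : V} (ha : a ∈ A) :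
    ∑ b ∈ A, b ∉ s.erase a := by
  intro hc
  have h1 := h.coord_sum_one hA ha
  rw [h.ne a (hA ha) _ (Finset.mem_of_mem_erase hc) (Finset.ne_of_mem_erase hc)] at h1
  exact zero_ne_one h1

/-- The coordinates after `a ∈ A` is replaced by the sum of `A`. -/
theorem insert_erase (h : IsFrame N s x) {A : Finset V} (hA : A ⊆ s) {a : V} (ha : a ∈ A) :
    IsFrame N (insert (∑ b ∈ A, b) (s.erase a))
      (fun r => if r = ∑ b ∈ A, b then x a else if r ∈ A then x r - x a else x r) := by
  have hc := h.sum_notMem_erase hA ha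
  have hne : ∀ b ∈ s.erase a, b ≠ ∑ b ∈ A, b := fun b hb hbc => hc (hbc ▸ hb)
  refine ⟨?_, ?_, ?_, ?_, ?_⟩
  · intro b hb
    rcases Finset.mem_insert.1 hb with rfl | hb
    · exact Submodule.sum_mem _ fun b hb => h.mem b (hA hb)
    · exact h.mem b (Finset.mem_of_mem_erase hb)
  · intro b hb
    rcases Finset.mem_insert.1 hb with rfl | hb
    · simpa using h.dual a (hA ha)
    · have hbs := Finset.mem_of_mem_erase hb
      simp only [if_neg (hne b hb)]
      split_ifs
      · exact Submodule.sub_mem _ (h.dual b hbs) (h.dual a (hA ha))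
      · exact h.dual b hbs
  · intro b hb
    rcases Finset.mem_insert.1 hb with rfl | hb
    · simpa using h.coord_sum_one hA ha
    · have hbs := Finset.mem_of_mem_erase hb
      simp only [if_neg (hne b hb)]
      split_ifs
      · simp [h.self b hbs, h.ne a (hA ha) b hbs (Finset.ne_of_mem_erase hb)]
      · exact h.self b hbs
  · intro r hr b hb hbr
    rcases Finset.mem_insert.1 hr with rfl | hr
    · have hb := Finset.mem_of_mem_insert_of_ne hb hbr
      simpa using h.ne a (hA ha) b (Finset.mem_of_mem_erase hb) (Finset.ne_of_mem_erase hb)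
    · have hrs := Finset.mem_of_mem_erase hr
      simp only [if_neg (hne r hr)]
      rcases Finset.mem_insert.1 hb with rfl | hb
      · split_ifs with hrA
        · rw [LinearMap.sub_apply, h.coord_sum_one hA ha, h.coord_sum_one hA hrA, sub_self]
        · exact h.coord_sum_zero hA hrs hrA
      · have hbs := Finset.mem_of_mem_erase hb
        split_ifs
        · simp [h.ne r hrs b hbs hbr, h.ne a (hA ha) b hbs (Finset.ne_of_mem_erase hb)]
        · exact h.ne r hrs b hbs hbr
  · intro v
    rw [Finset.sum_insert hc]
    have h1 : ∀ b ∈ s.erase a, (if b = ∑ b ∈ A, b then x a else if b ∈ A then x b - x a else x b) v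
        • b = x b v • b - if b ∈ A then x a v • b else 0 := by
      intro b hb
      rw [if_neg (hne b hb)]
      split_ifs
      · rw [LinearMap.sub_apply, sub_smul]
      · rw [sub_zero]
    rw [Finset.sum_congr rfl h1, Finset.sum_sub_distrib, ← Finset.sum_filter, if_pos rfl]
    have h2 : (s.erase a).filter (· ∈ A) = A.erase a := by
      ext b
      simp only [Finset.mem_filter, Finset.mem_erase]
      exact ⟨fun hb => ⟨hb.1.1, hb.2⟩, fun hb => ⟨⟨hb.1, hA hb.2⟩, hb.2⟩⟩
    rw [h2, ← Finset.smul_sum, ← Finset.add_sum_erase A _ ha]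
    conv_rhs => rw [← h.expand v, ← Finset.add_sum_erase s _ (hA ha)]
    rw [smul_add]
    abel

end IsFrame

namespace IsTriangulation

variable {N : Submodule ℤ V} {T : Set (Finset V)}

/-- If the sum were a vertex, convexity would bound its height by the value of the form of `s`. It
would then be a vertex of `s`, contrary to linear independence. -/
theorem sum_notMem_vertices (hT : IsTriangulation N T) {s A : Finset V} (hs : s ∈ T) (hA : A ⊆ s)
    (hcard : 1 < A.card) : ∑ b ∈ A, b ∉ vertices T := by
  intro hc
  obtain ⟨t, ht, hct⟩ := mem_vertices.1 hc
  obtain ⟨φ, hφ⟩ := hT.regular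
  obtain ⟨m, hm⟩ := hφ s hs
  obtain ⟨m', hm'⟩ := hφ t ht
  obtain ⟨x, hx⟩ := hT.frame s hs
  refine hx.sum_notMem hA hcard (hm.mem t ht _ hct (le_antisymm (hm.le t ht _ hct) ?_))
  rw [← hm'.eq _ hct, map_sum, map_sum]
  refine Finset.sum_le_sum fun a ha => ?_
  rw [hm.eq a (hA ha)]
  exact hm'.le s hs a (hA ha)

theorem starSubdivision_le {A t : Finset V} (ht : t ∈ starSubdivision T A) :
    ∃ s ∈ T, PointedCone.hull ℝ (t : Set V) ≤ PointedCone.hull ℝ (s : Set V) := by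
  classical
  rcases ht with ht | ⟨s, hs, hA, a, ha, rfl⟩
  · exact ⟨t, ht.1, le_rfl⟩
  · refine ⟨s, hs, Submodule.span_le.2 fun b hb => ?_⟩
    rcases Finset.mem_insert.1 hb with rfl | hb
    · exact Submodule.sum_mem _ fun b hb => Submodule.subset_span (hA hb)
    · exact Submodule.subset_span (Finset.mem_of_mem_erase hb)

theorem starSubdivision_cover (hT : IsTriangulation N T) {A : Finset V} (hA : A.Nonempty) (v : V) :
    ∃ t ∈ starSubdivision T A, v ∈ PointedCone.hull ℝ (t : Set V) := by
  classical
  obtain ⟨s, hs, hv⟩ := hT.cover v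
  by_cases hAs : A ⊆ s
  · obtain ⟨x, hx⟩ := hT.frame s hs
    -- Replacing `a` by the sum subtracts the coordinate of `a` from the other coordinates in `A`;
    -- they stay nonnegative when that coordinate is the smallest.
    obtain ⟨a, ha, hmin⟩ := A.exists_min_image (fun a => x a v) hA
    refine ⟨_, Or.inr ⟨s, hs, hAs, a, ha, rfl⟩, ?_⟩
    have hv' := hx.mem_hull_self.1 hv
    convert (hx.insert_erase hAs ha).mem_hull_self.2 fun b hb => ?_
    split_ifs with h1 h2
    · exact hv' a (hAs ha)
    · simpa using hmin b h2
    · exact hv' b (Finset.mem_of_mem_erase (Finset.mem_of_mem_insert_of_ne hb h1))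
  · exact ⟨s, Or.inl ⟨hs, hAs⟩, hv⟩

/-- Scaling the heights by `K` makes room for lowering the new vertex by one. The form of an
untouched simplex is only scaled; where `a` is replaced, its coordinate is also subtracted, which
lowers the value by one at `a` and at the new vertex. -/
theorem starSubdivision_regular (hT : IsTriangulation N T) {s A : Finset V} (hs : s ∈ T)
    (hA : A ⊆ s) (hcard : 1 < A.card) :
    ∃ φ : V → ℝ, ∀ t ∈ starSubdivision T A, ∃ m,
      IsSupportingForm N (starSubdivision T A) φ t m := by
  classical
  obtain ⟨φ, hφ⟩ := hT.regular
  have hcT := hT.sum_notMem_vertices hs hA hcard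
  choose! m hm using hφ
  choose! x hx using hT.frame
  have hne : ∀ t ∈ T, ∀ r ∈ t, r ≠ ∑ b ∈ A, b := fun t ht r hr h =>
    hcT (h ▸ mem_vertices.2 ⟨t, ht, hr⟩)
  have hmem : ∀ t ∈ T, ∀ r ∈ t, r ∈ N := fun t ht r hr => (hx t ht).mem r hr
  -- Heights of vertices are integers, so strict convexity has a gap of at least one, and `K` scales
  -- this gap.
  have hint : ∀ s ∈ T, ∀ t ∈ T, ∀ r ∈ t, r ∉ s → m s r ≤ φ r - 1 := by
    intro s hs t ht r hr hrs
    rw [← (hm t ht).eq r hr]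
    refine dualLattice_le_sub_one (hm s hs).dual (hm t ht).dual (hmem t ht r hr) ?_
    rw [(hm t ht).eq r hr]
    exact lt_of_le_of_ne ((hm s hs).le t ht r hr) fun h => hrs ((hm s hs).mem t ht r hr h)
  -- `1 < K` keeps the forms of untouched simplices strictly below the lowered height of the new
  -- vertex; the other bound makes the gap outweigh the subtracted coordinate at vertices outside
  -- `s`.
  obtain ⟨K, hK1, hK⟩ : ∃ K : ℕ, 1 < K ∧ ∀ s ∈ T, ∀ a ∈ A, ∀ r ∈ vertices T, -x s a r < K := by
    have hfin : (vertices T).Finite := hT.finite.biUnion fun s _ => s.finite_toSet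
    have hfin' : (T ×ˢ ((A : Set V) ×ˢ vertices T)).Finite :=
      hT.finite.prod (A.finite_toSet.prod hfin)
    obtain ⟨B, hB⟩ := (hfin'.image fun p => -x p.1 p.2.1 p.2.2).bddAbove
    obtain ⟨n, hn⟩ := exists_nat_gt B
    refine ⟨n + 2, by omega, fun s hs a ha r hr => ?_⟩
    have := hB ⟨(s, a, r), ⟨hs, ha, hr⟩, rfl⟩
    push_cast
    dsimp only at this
    linarith
  have hK1' : (1 : ℝ) < K := by exact_mod_cast hK1
  have hK0 : (0 : ℝ) < K := by linarith
  have hdual : ∀ s ∈ T, (K : ℝ) • m s ∈ dualLattice N := by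
    intro s hs
    rw [Nat.cast_smul_eq_nsmul]
    exact nsmul_mem (hm s hs).dual K
  refine ⟨Function.update (fun v => K * φ v) (∑ b ∈ A, b) (K * (∑ b ∈ A, φ b) - 1), ?_⟩
  set c := ∑ b ∈ A, b with hc
  set ψ : V → ℝ := Function.update (fun v => K * φ v) c (K * (∑ b ∈ A, φ b) - 1) with hψ
  have hψc : ψ c = K * (∑ b ∈ A, φ b) - 1 := Function.update_self ..
  have hψr : ∀ r ∈ vertices T, ψ r = K * φ r := fun r hr =>
    Function.update_of_ne (by rintro rfl; exact hcT hr) ..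
  suffices hmain : ∀ t ∈ starSubdivision T A, ∃ m' ∈ dualLattice N, (∀ r ∈ t, m' r = ψ r) ∧
      ∀ r ∈ insert c (vertices T), m' r ≤ ψ r ∧ (m' r = ψ r → r ∈ t) by
    intro t ht
    obtain ⟨m', h1, h2, h3⟩ := hmain t ht
    exact ⟨m', h1, h2,
      fun u hu r hr => (h3 r (vertices_starSubdivision_subset (mem_vertices.2 ⟨u, hu, hr⟩))).1,
      fun u hu r hr => (h3 r (vertices_starSubdivision_subset (mem_vertices.2 ⟨u, hu, hr⟩))).2⟩
  rintro t (⟨ht, hAt⟩ | ⟨s, hs, hA, a, ha, rfl⟩)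
  · refine ⟨(K : ℝ) • m t, hdual t ht, ?_, ?_⟩
    · intro r hr
      rw [hψr r (mem_vertices.2 ⟨t, ht, hr⟩), LinearMap.smul_apply, (hm t ht).eq r hr, smul_eq_mul]
    · rintro r (rfl | hr)
      · have hlt : ((K : ℝ) • m t) c < ψ c := by
          obtain ⟨a, ha, hat⟩ := Finset.not_subset.1 hAt
          have h1 : m t c ≤ ∑ b ∈ A, φ b - 1 := by
            rw [hc, map_sum, ← Finset.add_sum_erase A _ ha, ← Finset.add_sum_erase A φ ha]
            have := hint t ht s hs a (hA ha) hat
            have := Finset.sum_le_sum fun b (hb : b ∈ A.erase a) =>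
              (hm t ht).le s hs b (hA (Finset.mem_of_mem_erase hb))
            linarith
          rw [hψc, LinearMap.smul_apply, smul_eq_mul]
          have := mul_le_mul_of_nonneg_left h1 hK0.le
          linarith
        exact ⟨hlt.le, fun h => (hlt.ne h).elim⟩
      · obtain ⟨u, hu, hru⟩ := mem_vertices.1 hr
        rw [hψr r hr, LinearMap.smul_apply, smul_eq_mul]
        exact ⟨mul_le_mul_of_nonneg_left ((hm t ht).le u hu r hru) hK0.le,
          fun h => (hm t ht).mem u hu r hru (mul_left_cancel₀ hK0.ne' h)⟩
  · have hc1 : ((K : ℝ) • m s - x s a) c = ψ c := by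
      rw [LinearMap.sub_apply, LinearMap.smul_apply, (hx s hs).coord_sum_one hA ha, hψc, hc,
        map_sum, smul_eq_mul, Finset.sum_congr rfl fun b hb => (hm s hs).eq b (hA hb)]
    have hr1 : ∀ r ∈ s, r ≠ a → ((K : ℝ) • m s - x s a) r = ψ r := by
      intro r hr hra
      rw [hψr r (mem_vertices.2 ⟨s, hs, hr⟩), LinearMap.sub_apply, LinearMap.smul_apply,
        (hm s hs).eq r hr, (hx s hs).ne a (hA ha) r hr hra, sub_zero, smul_eq_mul]
    refine ⟨(K : ℝ) • m s - x s a,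
      Submodule.sub_mem _ (hdual s hs) ((hx s hs).dual a (hA ha)), ?_, ?_⟩
    · intro r hr
      rcases Finset.mem_insert.1 hr with rfl | hr
      · exact hc1
      · exact hr1 r (Finset.mem_of_mem_erase hr) (Finset.ne_of_mem_erase hr)
    · rintro r (rfl | hr)
      · exact ⟨hc1.le, fun _ => Finset.mem_insert_self _ _⟩
      · by_cases hrs : r ∈ s ∧ r ≠ a
        · exact ⟨(hr1 r hrs.1 hrs.2).le,
            fun _ => Finset.mem_insert_of_mem (Finset.mem_erase.2 hrs.symm)⟩
        · have hlt : ((K : ℝ) • m s - x s a) r < ψ r := by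
            rw [hψr r hr, LinearMap.sub_apply, LinearMap.smul_apply, smul_eq_mul]
            by_cases hrs' : r ∈ s
            · obtain rfl : r = a := not_not.1 fun h => hrs ⟨hrs', h⟩
              rw [(hm s hs).eq r hrs', (hx s hs).self r hrs']
              linarith
            · obtain ⟨u, hu, hru⟩ := mem_vertices.1 hr
              have h1 := mul_le_mul_of_nonneg_left (hint s hs u hu r hru hrs') hK0.le
              have h2 := hK s hs a ha r hr
              linarith
          exact ⟨hlt.le, fun h => (hlt.ne h).elim⟩

theorem isTriangulation_starSubdivision (hT : IsTriangulation N T) {s A : Finset V} (hs : s ∈ T) (hA : A ⊆ s)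
    (hcard : 1 < A.card) : IsTriangulation N (starSubdivision T A) where
  finite := starSubdivision_finite hT.finite A
  frame := by
    classical
    rintro t (ht | ⟨s, hs, hA, a, ha, rfl⟩)
    · exact hT.frame t ht.1
    · obtain ⟨x, hx⟩ := hT.frame s hs
      have := hx.insert_erase hA ha
      exact ⟨_, by convert this⟩
  cover := hT.starSubdivision_cover (Finset.card_pos.1 (zero_lt_one.trans hcard))
  regular := hT.starSubdivision_regular hs hA hcard

end IsTriangulation

end StarSubdivision

/-! ### Reflexive polytopes: integral inequalities and boundary points -/

section Polytopes

variable {V : Type*} [NormedAddCommGroup V] [NormedSpace ℝ V] {N : Submodule ℤ V} {P : Set V}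

theorem IsLatticePolytope.isCompact (h : IsLatticePolytope N P) : IsCompact P := by
  obtain ⟨S, -, rfl⟩ := h
  exact S.finite_toSet.isCompact_convexHull ℝ

theorem IsLatticePolytope.convex (h : IsLatticePolytope N P) : Convex ℝ P := by
  obtain ⟨S, -, rfl⟩ := h
  exact convex_convexHull ℝ _

theorem IsReflexive.frontier_subset (h : IsReflexive N P) : frontier P ⊆ P :=
  h.lattice.isCompact.isClosed.frontier_subset

theorem exists_one_lt_smul_mem {v : V} (hv : v ∈ interior P) : ∃ r : ℝ, 1 < r ∧ r • v ∈ P := by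
  have hcont : Filter.Tendsto (fun r : ℝ => r • v) (nhdsWithin 1 (Set.Ioi 1)) (nhds v) := by
    have : ContinuousAt (fun r : ℝ => r • v) 1 := by fun_prop
    simpa using this.tendsto.mono_left nhdsWithin_le_nhds
  have h := hcont.eventually (mem_interior_iff_mem_nhds.1 hv)
  obtain ⟨r, hr, hr'⟩ := (h.and self_mem_nhdsWithin).exists
  exact ⟨r, hr', hr⟩

theorem exists_pos_smul_mem (h0 : (0 : V) ∈ interior P) (v : V) : ∃ r : ℝ, 0 < r ∧ r • v ∈ P := by
  have hcont : Filter.Tendsto (fun r : ℝ => r • v) (nhdsWithin 0 (Set.Ioi 0)) (nhds 0) := by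
    have : ContinuousAt (fun r : ℝ => r • v) 0 := by fun_prop
    simpa using this.tendsto.mono_left nhdsWithin_le_nhds
  have h := hcont.eventually (mem_interior_iff_mem_nhds.1 h0)
  obtain ⟨r, hr, hr'⟩ := (h.and self_mem_nhdsWithin).exists
  exact ⟨r, hr', hr⟩

/-- A reflexive polytope is cut out by finitely many inequalities `ℓ ≤ 1` with integral `ℓ`. -/
theorem IsReflexive.exists_forms (h : IsReflexive N P) :
    ∃ S : Finset (Module.Dual ℝ V), (∀ ℓ ∈ S, ℓ ∈ dualLattice N) ∧ P = {x | ∀ ℓ ∈ S, ℓ x ≤ 1} := by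
  classical
  obtain ⟨S, hSN, hS⟩ := h.dual_lattice
  refine ⟨S.image (fun m => -m), ?_, ?_⟩
  · intro ℓ hℓ
    obtain ⟨m, hm, rfl⟩ := Finset.mem_image.1 hℓ
    exact Submodule.neg_mem _ (hSN m hm)
  · ext x
    simp only [Set.mem_ofPred_eq, Finset.forall_mem_image, LinearMap.neg_apply]
    constructor
    · intro hx m hm
      have hm' : m ∈ dualPolytope P := by
        rw [hS]; exact subset_convexHull ℝ _ hm
      linarith [hm' x hx]
    · intro hx
      by_contra hxP
      -- A separating form, normalized to `-f / u`, lies in the dual polytope but is less than `-1`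
      -- at `x`. This is impossible for a convex combination of the dual generators.
      obtain ⟨f, u, hf, hfx⟩ := geometric_hahn_banach_closed_point h.lattice.convex
        h.lattice.isCompact.isClosed hxP
      have hu : 0 < u := by simpa using hf 0 (interior_subset h.zero_mem_interior)
      have hmem : (-u⁻¹) • (f : Module.Dual ℝ V) ∈ dualPolytope P := by
        intro n hn
        have := mul_le_mul_of_nonneg_left (hf n hn).le (inv_nonneg.2 hu.le)
        rw [inv_mul_cancel₀ hu.ne'] at this
        simpa using this
      rw [hS] at hmem
      have hconv : Convex ℝ {m : Module.Dual ℝ V | -1 ≤ m x} :=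
        convex_halfSpace_ge (f := fun m : Module.Dual ℝ V => m x)
          ⟨fun _ _ => rfl, fun _ _ => rfl⟩ (-1)
      have hsub : (S : Set (Module.Dual ℝ V)) ⊆ {m : Module.Dual ℝ V | -1 ≤ m x} := by
        intro m hm
        have := hx hm
        change -1 ≤ m x
        linarith
      have h1 : -1 ≤ ((-u⁻¹) • (f : Module.Dual ℝ V)) x := convexHull_min hsub hconv hmem
      have h2 := mul_lt_mul_of_pos_left hfx (inv_pos.2 hu)
      rw [inv_mul_cancel₀ hu.ne'] at h2
      simp at h1
      linarith

/-- The only lattice point in the interior of a reflexive polytope is the origin. -/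
theorem IsReflexive.mem_frontier (h : IsReflexive N P) {v : V} (hvN : v ∈ N) (hvP : v ∈ P)
    (hv0 : v ≠ 0) : v ∈ frontier P := by
  obtain ⟨S, hSN, hS⟩ := h.exists_forms
  refine ⟨subset_closure hvP, fun hint => ?_⟩
  obtain ⟨r, hr, hrv⟩ := exists_one_lt_smul_mem hint
  -- An interior point satisfies `ℓ v < 1`, so `ℓ v ≤ 0` by integrality. Then all multiples `n • v`
  -- lie in `P`, which is bounded.
  have hneg : ∀ ℓ ∈ S, ℓ v ≤ 0 := by
    intro ℓ hℓ
    rw [hS] at hrv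
    have h1 := hrv ℓ hℓ
    rw [map_smul, smul_eq_mul] at h1
    obtain ⟨k, hk⟩ := hSN ℓ hℓ v hvN
    rw [hk] at h1 ⊢
    by_contra! hk0
    have : (1 : ℝ) ≤ k := by
      have : 0 < k := by exact_mod_cast hk0
      exact_mod_cast this
    nlinarith
  have hmem : ∀ n : ℕ, (n : ℝ) • v ∈ P := by
    intro n
    rw [hS]
    intro ℓ hℓ
    rw [map_smul, smul_eq_mul]
    have := mul_nonpos_of_nonneg_of_nonpos n.cast_nonneg (hneg ℓ hℓ)
    linarith
  obtain ⟨R, hR⟩ := h.lattice.isCompact.isBounded.exists_norm_le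
  obtain ⟨n, hn⟩ := exists_nat_gt (R / ‖v‖)
  have h1 := hR _ (hmem n)
  rw [norm_smul, Real.norm_natCast] at h1
  rw [div_lt_iff₀ (norm_pos_iff.2 hv0)] at hn
  linarith

theorem IsLatticePolytope.finite_inter [FiniteDimensional ℝ V] [DiscreteTopology N]
    (h : IsLatticePolytope N P) : (P ∩ N).Finite := by
  have := FiniteDimensional.proper ℝ V
  have hdisc : DiscreteTopology N.toAddSubgroup := ‹DiscreteTopology N›
  exact Metric.finite_isBounded_inter_isClosed ⟨hdisc⟩ h.isCompact.isBounded
    (AddSubgroup.isClosed_of_discrete (H := N.toAddSubgroup))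

/-- Write `a = r • x` with `x` in the face. A factor `r > 1` exceeds the maximum of `l`, and `r < 1`
moves the point into the interior. -/
theorem IsReflexive.mem_of_mem_coneOver (h : IsReflexive N P) {f : Set V} (hf : Convex ℝ f)
    {l : Module.Dual ℝ V} (hfl : f = {x ∈ P | ∀ y ∈ P, l y ≤ l x}) (hpos : ∀ x ∈ f, 0 < l x)
    (hne : f.Nonempty) {a : V} (ha : a ∈ frontier P) (haf : a ∈ coneOver f) : a ∈ f := by
  obtain ⟨r, hr, x, hx, rfl⟩ := (mem_coneOver hf hne a).1 haf
  have hx' := hx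
  rw [hfl] at hx'
  have h1 := hx'.2 _ (h.frontier_subset ha)
  rw [map_smul, smul_eq_mul] at h1
  have h2 := hpos x hx
  have hr1 : r ≤ 1 := by
    by_contra! hcon
    nlinarith
  rcases hr1.eq_or_lt with rfl | hr1
  · rwa [one_smul]
  · refine (ha.2 ?_).elim
    have := h.lattice.convex.combo_interior_self_mem_interior h.zero_mem_interior hx'.1
      (sub_pos.2 hr1) hr (by ring)
    simpa using this

/-- Boundary points of a reflexive polytope in the cone over a proper face lie at height one for
some integral form. -/
theorem IsReflexive.exists_form_eq_one [FiniteDimensional ℝ V] (h : IsReflexive N P) {f : Set V}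
    (hf : IsExposed ℝ P f) (hfP : f ≠ P) {s : Finset V} (hs : s.Nonempty)
    (hs0 : ∀ a ∈ s, a ≠ 0) (hsP : ∀ a ∈ s, a ∈ frontier P) (hsf : ∀ a ∈ s, a ∈ coneOver f) :
    ∃ ℓ ∈ dualLattice N, ∀ a ∈ s, ℓ a = 1 := by
  have hfne : f.Nonempty := by
    rw [Set.nonempty_iff_ne_empty]
    rintro rfl
    obtain ⟨a, ha⟩ := hs
    exact hs0 a ha (by simpa [coneOver] using hsf a ha)
  obtain ⟨l, hl⟩ := hf hfne
  have h0P := interior_subset h.zero_mem_interior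
  have hpos : ∀ x ∈ f, 0 < l x := by
    intro x hx
    rw [hl] at hx
    have hx0 : 0 ≤ l x := by simpa using hx.2 0 h0P
    refine lt_of_le_of_ne hx0 fun hlx => hfP ?_
    rw [hl]
    refine Set.Subset.antisymm (fun y hy => hy.1) fun y hy => ⟨hy, fun z hz => ?_⟩
    have hz0 := hx.2 z hz
    obtain ⟨r, hr, hry⟩ := exists_pos_smul_mem h.zero_mem_interior (-y)
    have h1 := hx.2 _ hry
    rw [← hlx, map_smul, map_neg, smul_eq_mul] at h1
    have : 0 ≤ l y := by
      by_contra! hcon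
      nlinarith
    linarith
  have hfconv : Convex ℝ f := hf.convex h.lattice.convex
  have hsf' : ∀ a ∈ s, a ∈ f := fun a ha => h.mem_of_mem_coneOver (l := (l : V →ₗ[ℝ] ℝ)) hfconv hl
    hpos hfne (hsP a ha) (hsf a ha)
  have hn : (0 : ℝ) < s.card := by exact_mod_cast hs.card_pos
  -- The barycentre lies in the proper face, hence outside the interior, so some defining inequality
  -- is tight there. Being at most one on `P`, that form equals one at every point of `s`.
  set b := ∑ a ∈ s, (s.card : ℝ)⁻¹ • a with hb
  have hbf : b ∈ f := hfconv.sum_mem (fun _ _ => inv_nonneg.2 hn.le)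
    (by rw [Finset.sum_const, nsmul_eq_mul, mul_inv_cancel₀ hn.ne']) hsf'
  have hbint : b ∉ interior P := by
    intro hint
    obtain ⟨r, hr, hrb⟩ := exists_one_lt_smul_mem hint
    have h1 := hpos b hbf
    rw [hl] at hbf
    have h2 := hbf.2 _ hrb
    rw [map_smul, smul_eq_mul] at h2
    nlinarith
  obtain ⟨S, hSN, hS⟩ := h.exists_forms
  obtain ⟨ℓ, hℓ, hℓb⟩ : ∃ ℓ ∈ S, 1 ≤ ℓ b := by
    by_contra! hcon
    refine hbint (mem_interior.2 ⟨{x | ∀ ℓ ∈ S, ℓ x < 1}, ?_, ?_, hcon⟩)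
    · intro x hx
      rw [hS]
      exact fun ℓ hℓ => (hx ℓ hℓ).le
    · have : {x : V | ∀ ℓ ∈ S, ℓ x < 1} = ⋂ ℓ ∈ S, {x | ℓ x < 1} := by ext; simp
      rw [this]
      exact isOpen_biInter_finset fun ℓ _ =>
        isOpen_lt ℓ.continuous_of_finiteDimensional continuous_const
  refine ⟨ℓ, hSN ℓ hℓ, ?_⟩
  have hle : ∀ a ∈ s, 0 ≤ 1 - ℓ a := by
    intro a ha
    have := h.frontier_subset (hsP a ha)
    rw [hS] at this
    exact sub_nonneg.2 (this ℓ hℓ)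
  have hsum : ∑ a ∈ s, (1 - ℓ a) = 0 := by
    refine le_antisymm ?_ (Finset.sum_nonneg hle)
    rw [hb, ← Finset.smul_sum, map_smul, map_sum, smul_eq_mul, ← div_eq_inv_mul, le_div_iff₀ hn,
      one_mul] at hℓb
    rw [Finset.sum_sub_distrib, Finset.sum_const, nsmul_eq_mul, mul_one]
    linarith
  intro a ha
  have := (Finset.sum_eq_zero_iff_of_nonneg hle).1 hsum a ha
  linarith

end Polytopes

/-! ### Unimodularity of elementary triangles -/

section Unimodular

variable {V : Type*} [AddCommGroup V] [Module ℝ V]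

/-- The coordinates are the dual basis. The lattice is at first only the one generated by `s`;
elementarity later identifies it with `N`. -/
theorem exists_isFrame_span {s : Finset V} (hli : LinearIndependent ℝ (fun v : s => (v : V)))
    (hsp : Submodule.span ℝ (s : Set V) = ⊤) :
    ∃ x, IsFrame (Submodule.span ℤ (s : Set V)) s x := by
  classical
  have hsp' : ⊤ ≤ Submodule.span ℝ (Set.range fun v : s => (v : V)) := by
    rw [← hsp]
    exact Submodule.span_mono fun v hv => ⟨⟨v, hv⟩, rfl⟩
  let b := Module.Basis.mk hli hsp'
  let x : V → Module.Dual ℝ V := fun a => if h : a ∈ s then b.coord ⟨a, h⟩ else 0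
  have hx : ∀ a (h : a ∈ s), x a = b.coord ⟨a, h⟩ := fun a h => dif_pos h
  have hb : ∀ a : s, b a = a := fun a => Module.Basis.mk_apply hli hsp' a
  have hself : ∀ a ∈ s, x a a = 1 := by
    intro a ha
    have h : b.repr a = Finsupp.single ⟨a, ha⟩ 1 := by rw [← b.repr_self ⟨a, ha⟩, hb]
    rw [hx a ha, Module.Basis.coord_apply, h, Finsupp.single_eq_same]
  have hne : ∀ a ∈ s, ∀ c ∈ s, c ≠ a → x a c = 0 := by
    intro a ha c hc hca
    rw [hx a ha, Module.Basis.coord_apply, show c = b ⟨c, hc⟩ from (hb ⟨c, hc⟩).symm,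
      Module.Basis.repr_self, Finsupp.single_eq_of_ne]
    intro h
    exact hca (congrArg Subtype.val h).symm
  refine ⟨x, fun a ha => Submodule.subset_span ha, ?_, hself, hne, ?_⟩
  · intro a ha v hv
    refine Submodule.span_induction (p := fun v _ => ∃ k : ℤ, x a v = k) ?_ ?_ ?_ ?_ hv
    · intro c hc
      by_cases h : c = a
      · exact ⟨1, by rw [h, hself a ha, Int.cast_one]⟩
      · exact ⟨0, by rw [hne a ha c hc h, Int.cast_zero]⟩
    · exact ⟨0, by simp⟩
    · rintro v w - - ⟨k, hk⟩ ⟨l, hl⟩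
      exact ⟨k + l, by simp [hk, hl]⟩
    · rintro c v - ⟨k, hk⟩
      exact ⟨c * k, by simp [hk]⟩
  · intro v
    rw [← Finset.sum_attach]
    conv_rhs => rw [← b.sum_repr v]
    refine Finset.sum_congr rfl fun a _ => ?_
    rw [hx a a.2, hb]
    rfl

/-- An elementary triangle at height one generates the lattice. -/
theorem span_eq_of_elementary {N : Submodule ℤ V} {s : Finset V} (hcard : s.card = 3)
    {x : V → Module.Dual ℝ V} (hx : IsFrame (Submodule.span ℤ (s : Set V)) s x)
    (hsN : ∀ a ∈ s, a ∈ N) (hel : ∀ v ∈ convexHull ℝ (s : Set V), v ∈ N → v ∈ s)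
    {ℓ : Module.Dual ℝ V} (hℓ : ℓ ∈ dualLattice N) (hℓs : ∀ a ∈ s, ℓ a = 1) :
    Submodule.span ℤ (s : Set V) = N := by
  refine le_antisymm (Submodule.span_le.2 hsN) fun v hv => ?_
  have hfl : ∀ a : V, ((⌊x a v⌋ : ℤ) : ℝ) • a = ⌊x a v⌋ • a := fun a => Int.cast_smul_eq_zsmul ℝ _ a
  have hflspan : ∑ a ∈ s, ((⌊x a v⌋ : ℤ) : ℝ) • a ∈ Submodule.span ℤ (s : Set V) := by
    simp only [hfl]
    exact Submodule.sum_mem _ fun a ha => Submodule.smul_mem _ _ (Submodule.subset_span ha)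
  have hsplit : v = ∑ a ∈ s, Int.fract (x a v) • a + ∑ a ∈ s, ((⌊x a v⌋ : ℤ) : ℝ) • a := by
    rw [← Finset.sum_add_distrib]
    simp only [← add_smul, Int.fract_add_floor]
    exact (hx.expand v).symm
  -- Reduce `v` to the half-open parallelepiped spanned by `s`. The height `ℓ w` is an integer in
  -- `[0, 3)`, and only height zero will be possible without making `w` vanish artificially: at
  -- height one `w` itself lies in the triangle, at height two its reflection `∑ a - w` does.
  set w := ∑ a ∈ s, Int.fract (x a v) • a with hw
  have hwN : w ∈ N := by
    rw [eq_sub_of_add_eq hsplit.symm]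
    exact Submodule.sub_mem _ hv (Submodule.span_le.2 hsN hflspan)
  have hxw : ∀ a ∈ s, x a w = Int.fract (x a v) := fun a ha =>
    hx.coord_sum subset_rfl (fun a => Int.fract (x a v)) ha
  have hℓw : ℓ w = ∑ a ∈ s, Int.fract (x a v) := by
    rw [hw, map_sum]
    exact Finset.sum_congr rfl fun a ha => by rw [map_smul, hℓs a ha, smul_eq_mul, mul_one]
  obtain ⟨k, hk⟩ := hℓ w hwN
  have hne : s.Nonempty := Finset.card_pos.1 (by omega)
  have hk0 : 0 ≤ k := by
    have : (0 : ℝ) ≤ k := by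
      rw [← hk, hℓw]; exact Finset.sum_nonneg fun a _ => Int.fract_nonneg _
    exact_mod_cast this
  have hk3 : k < 3 := by
    have : (k : ℝ) < 3 := by
      rw [← hk, hℓw]
      calc ∑ a ∈ s, Int.fract (x a v) < ∑ _a ∈ s, (1 : ℝ) :=
            Finset.sum_lt_sum_of_nonempty hne fun a _ => Int.fract_lt_one _
        _ = 3 := by simp [hcard]
    exact_mod_cast this
  have hk' : k = 0 ∨ k = 1 ∨ k = 2 := by omega
  rw [hℓw] at hk
  rcases hk' with rfl | rfl | rfl
  · have h0 := (Finset.sum_eq_zero_iff_of_nonneg fun a _ => Int.fract_nonneg _).1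
      (hk.trans Int.cast_zero)
    have : w = 0 := Finset.sum_eq_zero fun a ha => by rw [h0 a ha, zero_smul]
    rw [hsplit, this, zero_add]
    exact hflspan
  · have hws : w ∈ s := hel w (Finset.mem_convexHull'.2
      ⟨fun a => Int.fract (x a v), fun a _ => Int.fract_nonneg _, by simpa using hk, rfl⟩) hwN
    have h1 := hx.self w hws
    rw [hxw w hws] at h1
    exact ((Int.fract_lt_one _).ne h1).elim
  · set u := ∑ a ∈ s, (1 - Int.fract (x a v)) • a with hu
    have huw : u = ∑ a ∈ s, a - w := by
      simp only [hu, hw, sub_smul, one_smul, Finset.sum_sub_distrib]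
    have huN : u ∈ N := by
      rw [huw]
      exact Submodule.sub_mem _ (Submodule.sum_mem _ hsN) hwN
    have hus : u ∈ s := hel u (Finset.mem_convexHull'.2
      ⟨fun a => 1 - Int.fract (x a v), fun a _ => by linarith [Int.fract_lt_one (x a v)], by
        rw [Finset.sum_sub_distrib, hk, Finset.sum_const, hcard]; norm_num, rfl⟩) huN
    obtain ⟨a, ha, hau⟩ := Finset.exists_mem_ne (by omega : 1 < s.card) u
    have h1 := hx.ne a ha u hus hau.symm
    rw [hx.coord_sum subset_rfl (fun a => 1 - Int.fract (x a v)) ha] at h1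
    have := Int.fract_lt_one (x a v)
    linarith

end Unimodular

/-! ### From an MPCP subdivision to a triangulation -/

section FanTriangulation

variable {V : Type*} [AddCommGroup V] [Module ℝ V]

theorem IsFan.exists_le_maximal {N : Submodule ℤ V} {F : Set (PointedCone ℝ V)} (hF : IsFan N F)
    {σ : PointedCone ℝ V} (hσ : σ ∈ F) : ∃ τ, IsMaximalCone F τ ∧ σ ≤ τ := by
  obtain ⟨τ, h1, h2⟩ := hF.finite.exists_le_maximal hσ
  exact ⟨τ, h2, h1⟩

/-- A maximal cone of a projective fan spans the space. -/
theorem IsFan.span_eq_top {N : Submodule ℤ V} {F : Set (PointedCone ℝ V)} (hF : IsFan N F)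
    (hproj : IsProjectiveFan N F) {s : Finset V}
    (hs : IsMaximalCone F (PointedCone.hull ℝ (s : Set V))) :
    Submodule.span ℝ (s : Set V) = ⊤ := by
  by_contra hspan
  obtain ⟨y, hy⟩ : ∃ y, y ∉ Submodule.span ℝ (s : Set V) := by
    by_contra! h
    exact hspan (eq_top_iff.2 fun y _ => h y)
  obtain ⟨hsupp, φ, -, hφ⟩ := hproj
  choose! m hmN hm hm' using hφ
  set σ := PointedCone.hull ℝ (s : Set V) with hσ
  set v := ∑ a ∈ s, a with hv
  have hvσ : v ∈ σ := Submodule.sum_mem _ fun a ha => Submodule.subset_span ha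
  have hle : ∀ τ, IsMaximalCone F τ → ∀ z, m τ z ≤ φ z := by
    intro τ hτ z
    by_cases hz : z ∈ τ
    · exact (hm τ hτ z hz).ge
    · exact (hm' τ hτ z hz).le
  -- The sum `v` of all generators lies in no proper face of `σ`, so a cone that contains `v`
  -- contains `σ`.
  have hnot : ∀ τ, IsMaximalCone F τ → τ ≠ σ → v ∉ τ := by
    intro τ hτ hne hvτ
    refine hne (hs.eq_of_le hτ.prop ?_).symm
    have hface := (hF.inter_face σ hs.prop τ hτ.prop).1
    refine Submodule.span_le.2 fun a ha => ?_
    exact (mem_face_of_pos (c := fun _ => 1) hface (fun _ _ => zero_le_one)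
      (by simpa using ⟨hvσ, hvτ⟩) ha zero_lt_one).2
  -- At `v` the form of `σ` is strictly larger than the others, and it stays so after a small move
  -- in the direction `y`. The moved point therefore still lies in `σ`, which puts `y` in the span.
  have hev : ∀ᶠ ε in nhdsWithin (0 : ℝ) (Set.Ioi 0), ∀ τ ∈ F, IsMaximalCone F τ → τ ≠ σ →
      m τ (v + ε • y) < m σ (v + ε • y) := by
    rw [Filter.eventually_all_finite hF.finite]
    intro τ _
    by_cases hτ : IsMaximalCone F τ ∧ τ ≠ σ
    · have h1 : m τ v < m σ v := by
        rw [← hm σ hs v hvσ]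
        exact hm' τ hτ.1 v (hnot τ hτ.1 hτ.2)
      have hc : ContinuousAt (fun ε : ℝ => m σ v + ε * m σ y - (m τ v + ε * m τ y)) 0 := by
        fun_prop
      have h2 := hc.tendsto.eventually_const_lt (u := 0) (by simpa using h1)
      filter_upwards [nhdsWithin_le_nhds h2] with ε hε _ _
      simp only [map_add, map_smul, smul_eq_mul]
      linarith
    · exact Filter.Eventually.of_forall fun ε h1 h2 => (hτ ⟨h1, h2⟩).elim
  obtain ⟨ε, hε, hε0⟩ := (hev.and self_mem_nhdsWithin).exists
  have hz : v + ε • y ∈ fanSupport F := hsupp ▸ Set.mem_univ _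
  obtain ⟨ρ, hρ, hzρ⟩ := Set.mem_iUnion₂.1 hz
  obtain ⟨τ, hτ, hρτ⟩ := hF.exists_le_maximal hρ
  have hzτ : v + ε • y ∈ τ := hρτ hzρ
  have hτσ : τ = σ := by
    by_contra hne
    have h1 := hε τ hτ.prop hτ hne
    rw [← hm τ hτ _ hzτ] at h1
    exact h1.not_ge (hle σ hs _)
  rw [hτσ] at hzτ
  have hz' : v + ε • y ∈ Submodule.span ℝ (s : Set V) := PointedCone.hull_le_span _ _ hzτ
  have hv' : v ∈ Submodule.span ℝ (s : Set V) :=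
    Submodule.sum_mem _ fun a ha => Submodule.subset_span ha
  have h3 := (Submodule.add_mem_iff_right _ hv').1 hz'
  exact hy ((Submodule.smul_mem_iff _ (ne_of_gt hε0)).1 h3)

end FanTriangulation

section MPCP

variable {V : Type*} [NormedAddCommGroup V] [NormedSpace ℝ V]

/-- The generators lie on the boundary and in the cone over one proper face, so they have height one
for an integral form. Elementarity then makes them a lattice basis. -/
theorem IsMPCP.exists_isFrame (hdim : Module.finrank ℝ V = 3) {N : Submodule ℤ V} {P : Set V}
    (hP : IsReflexive N P) {F : Set (PointedCone ℝ V)} (hF : IsMPCP N P F) {σ : PointedCone ℝ V}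
    (hσ : IsMaximalCone F σ) :
    ∃ s : Finset V, σ = PointedCone.hull ℝ (s : Set V) ∧ (∀ a ∈ s, a ∈ frontier P) ∧
      ∃ x, IsFrame N s x := by
  have : FiniteDimensional ℝ V := Module.finite_of_finrank_pos (by omega)
  obtain ⟨s, hprim, hli, hσs, hel⟩ := hF.elementary σ hσ
  rw [coneOver_convexHull] at hσs
  subst hσs
  obtain ⟨x, hx⟩ := exists_isFrame_span hli (hF.isFan.span_eq_top hF.projective hσ)
  have hcard : s.card = 3 := by rw [hx.card_eq, hdim]
  have hfr : ∀ a ∈ s, a ∈ frontier P := by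
    intro a ha
    refine hF.ray_mem a (hprim a ha) (hF.isFan.face_mem _ hσ.prop _ ?_)
    have := hx.isFaceOf subset_rfl (Finset.singleton_subset_iff.2 ha)
    rwa [Finset.coe_singleton] at this
  obtain ⟨_, ⟨g, hg, hgP, rfl⟩, hle⟩ := hF.refines.2 _ hσ.prop
  obtain ⟨ℓ, hℓ, hℓs⟩ := hP.exists_form_eq_one hg hgP (Finset.card_pos.1 (by omega))
    (fun a ha => hx.ne_zero ha) hfr (fun a ha => hle (Submodule.subset_span ha))
  refine ⟨s, rfl, hfr, x, ?_⟩
  rwa [span_eq_of_elementary hcard hx (fun a ha => (hprim a ha).1) hel hℓ hℓs] at hx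

/-- The maximal cones of an MPCP subdivision form a regular unimodular triangulation. -/
theorem IsMPCP.exists_isTriangulation (hdim : Module.finrank ℝ V = 3) {N : Submodule ℤ V}
    {P : Set V} (hP : IsReflexive N P) {F : Set (PointedCone ℝ V)} (hF : IsMPCP N P F) :
    ∃ T, IsTriangulation N T ∧ vertices T ⊆ P ∧ ∀ s ∈ T, PointedCone.hull ℝ (s : Set V) ∈ F := by
  have hfr : ∀ σ, IsMaximalCone F σ → _ := fun σ hσ => hF.exists_isFrame hdim hP hσ
  choose! S hS hSP hSx using hfr
  obtain ⟨hsupp, φ, -, hφ⟩ := hF.projective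
  choose! m hmN hm hm' using hφ
  refine ⟨S '' {σ | IsMaximalCone F σ}, ⟨?_, ?_, ?_, φ, ?_⟩, ?_, ?_⟩
  · exact (hF.isFan.finite.subset fun σ hσ => hσ.prop).image S
  · rintro _ ⟨σ, hσ, rfl⟩
    exact hSx σ hσ
  · intro v
    have hv : v ∈ fanSupport F := hsupp ▸ Set.mem_univ v
    obtain ⟨ρ, hρ, hvρ⟩ := Set.mem_iUnion₂.1 hv
    obtain ⟨τ, hτ, hρτ⟩ := hF.isFan.exists_le_maximal hρ
    refine ⟨S τ, ⟨τ, hτ, rfl⟩, ?_⟩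
    rw [← hS τ hτ]
    exact hρτ hvρ
  · rintro _ ⟨σ, hσ, rfl⟩
    have hmemS : ∀ τ, IsMaximalCone F τ → ∀ r ∈ S τ, r ∈ τ := by
      intro τ hτ r hr
      rw [hS τ hτ]
      exact Submodule.subset_span hr
    refine ⟨m σ, hmN σ hσ, fun r hr => (hm σ hσ r (hmemS σ hσ r hr)).symm, ?_, ?_⟩
    · rintro _ ⟨τ, hτ, rfl⟩ r -
      by_cases hr : r ∈ σ
      · exact (hm σ hσ r hr).ge
      · exact (hm' σ hσ r hr).le
    · rintro _ ⟨τ, hτ, rfl⟩ r hr hmr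
      have hrσ : r ∈ σ := by
        by_contra h
        exact (hm' σ hσ r h).ne hmr
      obtain ⟨x, hx⟩ := hSx σ hσ
      obtain ⟨y, hy⟩ := hSx τ hτ
      have hface := hF.isFan.inter_face σ hσ.prop τ hτ.prop
      -- The ray of `r` is a face of `τ` inside `σ ⊓ τ`, hence a face of `σ`. It thus contains a
      -- generator of `σ`, which equals `r` since both are primitive.
      have hray : (PointedCone.hull ℝ ({r} : Set V)).IsFaceOf τ := by
        have := hy.isFaceOf subset_rfl (Finset.singleton_subset_iff.2 hr)
        rwa [Finset.coe_singleton, ← hS τ hτ] at this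
      have hrle : PointedCone.hull ℝ ({r} : Set V) ≤ σ ⊓ τ :=
        Submodule.span_le.2 (Set.singleton_subset_iff.2 ⟨hrσ, hmemS τ hτ r hr⟩)
      have hrayσ : (PointedCone.hull ℝ ({r} : Set V)).IsFaceOf
          (PointedCone.hull ℝ (S σ : Set V)) := by
        rw [← hS σ hσ]
        exact ((hray.isFaceOf_iff_le hface.2).2 hrle).trans hface.1
      have hrσ' := hrσ
      rw [hS σ hσ] at hrσ'
      obtain ⟨c, hc, hcr⟩ := mem_hull_finset.1 hrσ'
      obtain ⟨a, ha, hca⟩ : ∃ a ∈ S σ, c a ≠ 0 := by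
        by_contra! hcon
        refine hy.ne_zero hr ?_
        rw [← hcr]
        exact Finset.sum_eq_zero fun a ha => by rw [hcon a ha, zero_smul]
      have har := mem_face_of_pos hrayσ hc (by rw [hcr]; exact Submodule.subset_span rfl) ha
        (lt_of_le_of_ne (hc a ha) hca.symm)
      obtain ⟨d, hd⟩ := Submodule.mem_span_singleton.1 har
      rw [← hy.eq_of_isPrimitive hr (hx.isPrimitive ha) d.2 hd.symm]
      exact ha
  · intro v hv
    obtain ⟨_, ⟨σ, hσ, rfl⟩, hvσ⟩ := mem_vertices.1 hv
    exact hP.frontier_subset (hSP σ hσ v hvσ)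
  · rintro _ ⟨σ, hσ, rfl⟩
    rw [← hS σ hσ]
    exact hσ.prop

end MPCP

/-! ### Simplices in facets, and the final refinement -/

section Facets

variable {V : Type*} [NormedAddCommGroup V] [NormedSpace ℝ V] {N : Submodule ℤ V} {P : Set V}

/-- For a lattice basis `u, v, w` and forms `ℓ = (1, 1, 0)`, `m₂ = (-α, 1, 1)`, `m₃ = (1, -β, 1)`
bounded by one on a lattice polytope, the lattice points of the facet `ℓ = 1` have nonpositive
`w`-coordinate, and so have all points of this facet. -/
theorem IsLatticePolytope.notMem_of_forms (hP : IsLatticePolytope N P) {u v w : V}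
    {x : V → Module.Dual ℝ V} (hxu : x u ∈ dualLattice N)
    (hexp : ∀ (m : Module.Dual ℝ V) (z : V), m z = x u z * m u + x v z * m v + x w z * m w)
    {ℓ m₂ m₃ : Module.Dual ℝ V} (hℓN : ℓ ∈ dualLattice N)
    (hℓ : ∀ z ∈ P, ℓ z ≤ 1) (hm₂ : ∀ z ∈ P, m₂ z ≤ 1) (hm₃ : ∀ z ∈ P, m₃ z ≤ 1)
    (hℓu : ℓ u = 1) (hℓv : ℓ v = 1) (hℓw : ℓ w = 0) (h₂u : m₂ u ≤ 0) (h₂v : m₂ v = 1)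
    (h₂w : m₂ w = 1) (h₃u : m₃ u = 1) (h₃v : m₃ v ≤ 0) (h₃w : m₃ w = 1)
    {q : V} (hℓq : ℓ q = 1) (hxq : 0 < x w q) : q ∉ P := by
  obtain ⟨S, hSN, hS⟩ := hP
  obtain ⟨B, hB⟩ := (S.finite_toSet.image (x w)).bddAbove
  set L := max B 0 with hL
  have hL0 : 0 ≤ L := le_max_right _ _
  -- One inequality for all of `P`: on the facet `ℓ = 1` it reads `x w z ≤ 0`, and generators off
  -- the facet have `ℓ ≤ 0`, so that the bound `L` on `x w` suffices.
  have hsub : (S : Set V) ⊆ {z | (x w + L • ℓ) z ≤ L} := by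
    intro p hp
    have hpP : p ∈ P := by rw [hS]; exact subset_convexHull ℝ _ hp
    have hwL : x w p ≤ L := (hB ⟨p, hp, rfl⟩).trans (le_max_left _ _)
    have h1 := hℓ p hpP
    obtain ⟨k, hk⟩ := hℓN p (hSN p hp)
    simp only [Set.mem_ofPred_eq, LinearMap.add_apply, LinearMap.smul_apply, smul_eq_mul]
    have hk1 : k ≤ 1 := by rw [hk] at h1; exact_mod_cast h1
    rcases hk1.eq_or_lt with rfl | hk1
    · have h2 := hm₂ p hpP
      have h3 := hm₃ p hpP
      rw [hexp ℓ, hℓu, hℓv, hℓw, Int.cast_one] at hk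
      rw [hexp m₂, h₂v, h₂w] at h2
      rw [hexp m₃, h₃u, h₃w] at h3
      rw [hexp ℓ, hℓu, hℓv, hℓw]
      -- On the facet the coordinates of `u` and `v` are integers with sum one, so one of them is at
      -- most zero. If it is that of `u`, use `m₂`, otherwise `m₃`.
      have hw0 : x w p ≤ 0 := by
        obtain ⟨a, ha⟩ := hxu p (hSN p hp)
        rcases le_or_gt a 0 with ha0 | ha0
        · have ha0' : x u p ≤ 0 := by rw [ha]; exact_mod_cast ha0
          have := mul_nonneg_of_nonpos_of_nonpos ha0' h₂u
          linarith
        · have ha0' : 1 ≤ x u p := by rw [ha]; exact_mod_cast ha0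
          have : 0 ≤ x v p * m₃ v := mul_nonneg_of_nonpos_of_nonpos (by linarith) h₃v
          linarith
      rw [hk]
      linarith
    · have : (k : ℝ) ≤ 0 := by
        have : k ≤ 0 := by omega
        exact_mod_cast this
      rw [hk]
      have := mul_nonpos_of_nonneg_of_nonpos hL0 this
      linarith
  intro hq
  rw [hS] at hq
  have h1 := convexHull_min hsub (convex_halfSpace_le (x w + L • ℓ).isLinear L) hq
  simp only [Set.mem_ofPred_eq, LinearMap.add_apply, LinearMap.smul_apply, smul_eq_mul, hℓq] at h1
  linarith

/-- A lattice basis of vectors in a reflexive polytope, no two and no three of which have their sum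
in the polytope, lies in a facet. -/
theorem IsReflexive.exists_facet (hP : IsReflexive N P) {s : Finset V} {x : V → Module.Dual ℝ V}
    (hx : IsFrame N s x) (hcard : s.card = 3) (hsP : ∀ a ∈ s, a ∈ P)
    (hsum : ∀ A ⊆ s, 1 < A.card → ∑ a ∈ A, a ∉ P) :
    ∃ ℓ : Module.Dual ℝ V, (∀ z ∈ P, ℓ z ≤ 1) ∧ ∀ a ∈ s, ℓ a = 1 := by
  classical
  obtain ⟨S, hSN, hS⟩ := hP.exists_forms
  have hSP : ∀ ℓ ∈ S, ∀ z ∈ P, ℓ z ≤ 1 := by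
    intro ℓ hℓ z hz
    rw [hS] at hz
    exact hz ℓ hℓ
  have hnot : ∀ z, z ∉ P → ∃ ℓ ∈ S, 1 < ℓ z := by
    intro z hz
    by_contra! hcon
    exact hz (by rw [hS]; exact hcon)
  by_contra! hno
  have hint : ∀ ℓ ∈ S, ∀ a ∈ s, ℓ a = 1 ∨ ℓ a = 0 ∨ ℓ a ≤ -1 := by
    intro ℓ hℓ a ha
    obtain ⟨k, hk⟩ := hSN ℓ hℓ a (hx.mem a ha)
    have h1 := hSP ℓ hℓ a (hsP a ha)
    rw [hk] at h1 ⊢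
    have hk1 : k ≤ 1 := by exact_mod_cast h1
    have : k = 1 ∨ k = 0 ∨ k ≤ -1 := by omega
    exact_mod_cast this
  obtain ⟨u, v, w, huv, huw, hvw, rfl⟩ := Finset.card_eq_three.1 hcard
  have hu : u ∈ ({u, v, w} : Finset V) := by simp
  have hv : v ∈ ({u, v, w} : Finset V) := by simp
  have hw : w ∈ ({u, v, w} : Finset V) := by simp
  have hno' : ∀ ℓ ∈ S, ℓ u = 1 → ℓ v = 1 → ℓ w = 1 → False := by
    intro ℓ hℓ h1 h2 h3
    obtain ⟨a, ha, hne⟩ := hno ℓ (hSP ℓ hℓ)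
    simp only [Finset.mem_insert, Finset.mem_singleton] at ha
    rcases ha with rfl | rfl | rfl <;> exact hne ‹_›
  have hpair : ∀ a ∈ ({u, v, w} : Finset V), ∀ b ∈ ({u, v, w} : Finset V), a ≠ b →
      ∃ ℓ ∈ S, ℓ a = 1 ∧ ℓ b = 1 := by
    intro a ha b hb hab
    obtain ⟨ℓ, hℓ, h⟩ := hnot _ (hsum {a, b}
      (Finset.insert_subset ha (Finset.singleton_subset_iff.2 hb))
      (by rw [Finset.card_pair hab]; omega))
    rw [Finset.sum_pair hab, map_add] at h
    refine ⟨ℓ, hℓ, ?_⟩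
    rcases hint ℓ hℓ a ha with h1 | h1 | h1 <;> rcases hint ℓ hℓ b hb with h2 | h2 | h2 <;>
      first | exact ⟨h1, h2⟩ | (exfalso; linarith)
  have hsum3 : ∑ a ∈ ({u, v, w} : Finset V), a = u + v + w := by
    rw [Finset.sum_insert (by simp [huv, huw]), Finset.sum_pair hvw, add_assoc]
  have hexp : ∀ (m : Module.Dual ℝ V) (z : V), m z = x u z * m u + x v z * m v + x w z * m w := by
    intro m z
    rw [hx.apply_eq m z, Finset.sum_insert (by simp [huv, huw]), Finset.sum_pair hvw, add_assoc]
  -- A form that excludes `q` from `P` would have sum greater than two on `u, v, w`, so it would be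
  -- one on all three.
  set q := (2⁻¹ : ℝ) • (u + v + w) with hq
  have hqP : q ∈ P := by
    by_contra hqP
    obtain ⟨ℓ, hℓ, h⟩ := hnot q hqP
    rw [hq, map_smul, map_add, map_add, smul_eq_mul] at h
    have h1 := hSP ℓ hℓ u (hsP u hu)
    have h2 := hSP ℓ hℓ v (hsP v hv)
    have h3 := hSP ℓ hℓ w (hsP w hw)
    refine hno' ℓ hℓ ?_ ?_ ?_
    · rcases hint ℓ hℓ u hu with h4 | h4 | h4
      · exact h4
      all_goals exfalso; linarith
    · rcases hint ℓ hℓ v hv with h4 | h4 | h4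
      · exact h4
      all_goals exfalso; linarith
    · rcases hint ℓ hℓ w hw with h4 | h4 | h4
      · exact h4
      all_goals exfalso; linarith
  obtain ⟨m₁, hm₁, h₁u, h₁v⟩ := hpair u hu v hv huv
  obtain ⟨m₂, hm₂, h₂v, h₂w⟩ := hpair v hv w hw hvw
  obtain ⟨m₃, hm₃, h₃u, h₃w⟩ := hpair u hu w hw huw
  have h₁w : m₁ w ≤ 0 := by
    rcases hint m₁ hm₁ w hw with h | h | h
    · exact (hno' m₁ hm₁ h₁u h₁v h).elim
    all_goals linarith
  have h₂u : m₂ u ≤ 0 := by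
    rcases hint m₂ hm₂ u hu with h | h | h
    · exact (hno' m₂ hm₂ h h₂v h₂w).elim
    all_goals linarith
  have h₃v : m₃ v ≤ 0 := by
    rcases hint m₃ hm₃ v hv with h | h | h
    · exact (hno' m₃ hm₃ h₃u h h₃w).elim
    all_goals linarith
  have hcoord : ∀ a ∈ ({u, v, w} : Finset V), 0 < x a q := by
    intro a ha
    rw [hq, ← hsum3, map_smul, hx.coord_sum_one subset_rfl ha]
    norm_num
  have hℓq : ∀ ℓ : Module.Dual ℝ V, ℓ u + ℓ v + ℓ w = 2 → ℓ q = 1 := by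
    intro ℓ h
    rw [hq, map_smul, map_add, map_add, h]
    norm_num
  -- The values of `ℓ` are integers at most one with sum greater than one, and not all one: they are
  -- `1, 1, 0` in some order. Then `ℓ q = 1`, and the three orders are symmetric.
  obtain ⟨ℓ, hℓ, h⟩ := hnot _ (hsum _ subset_rfl (by omega))
  rw [hsum3, map_add, map_add] at h
  rcases hint ℓ hℓ u hu with h1 | h1 | h1 <;> rcases hint ℓ hℓ v hv with h2 | h2 | h2 <;>
    rcases hint ℓ hℓ w hw with h3 | h3 | h3 <;> first
    | exact hno' ℓ hℓ h1 h2 h3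
    | (exfalso; linarith)
    | exact hP.lattice.notMem_of_forms (u := u) (v := v) (w := w) (hx.dual u hu) hexp (hSN ℓ hℓ)
        (hSP ℓ hℓ) (hSP m₂ hm₂) (hSP m₃ hm₃) h1 h2 h3 h₂u h₂v h₂w h₃u h₃v h₃w
        (hℓq ℓ (by linarith)) (hcoord w hw) hqP
    | exact hP.lattice.notMem_of_forms (u := u) (v := w) (w := v) (hx.dual u hu)
        (fun m z => by rw [hexp m z]; ring) (hSN ℓ hℓ)
        (hSP ℓ hℓ) (hSP m₂ hm₂) (hSP m₁ hm₁) h1 h3 h2 h₂u h₂w h₂v h₁u h₁w h₁v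
        (hℓq ℓ (by linarith)) (hcoord v hv) hqP
    | exact hP.lattice.notMem_of_forms (u := v) (v := w) (w := u) (hx.dual v hv)
        (fun m z => by rw [hexp m z]; ring) (hSN ℓ hℓ)
        (hSP ℓ hℓ) (hSP m₃ hm₃) (hSP m₁ hm₁) h2 h3 h1 h₃v h₃w h₃u h₁v h₁w h₁u
        (hℓq ℓ (by linarith)) (hcoord u hu) hqP

theorem mem_faceFan_of_form [FiniteDimensional ℝ V] (h0 : (0 : V) ∈ P) {ℓ : Module.Dual ℝ V}
    (hℓ : ∀ z ∈ P, ℓ z ≤ 1) {a : V} (ha : a ∈ P) (hℓa : ℓ a = 1) :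
    coneOver {y ∈ P | ℓ y = 1} ∈ faceFan P := by
  refine ⟨_, fun _ => ⟨LinearMap.toContinuousLinearMap ℓ, ?_⟩, ?_, rfl⟩
  · ext y
    simp only [Set.mem_ofPred_eq, LinearMap.coe_toContinuousLinearMap', and_congr_right_iff]
    intro hy
    exact ⟨fun h z hz => h ▸ hℓ z hz, fun h => le_antisymm (hℓ y hy) (hℓa ▸ h a ha)⟩
  · intro h
    rw [← h] at h0
    have := h0.2
    rw [map_zero] at this
    exact zero_ne_one this

/-- Repeated star subdivision at lattice points of the polytope. -/
theorem IsTriangulation.exists_refinement {T : Set (Finset V)} (hT : IsTriangulation N T)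
    (hfin : (P ∩ N).Finite) (hTP : vertices T ⊆ P) :
    ∃ T', IsTriangulation N T' ∧ vertices T' ⊆ P ∧
      (∀ t ∈ T', ∃ s ∈ T, PointedCone.hull ℝ (t : Set V) ≤ PointedCone.hull ℝ (s : Set V)) ∧
      ∀ t ∈ T', ∀ A ⊆ t, 1 < A.card → ∑ a ∈ A, a ∉ P := by
  have hsub : ∀ T, IsTriangulation N T → vertices T ⊆ P → vertices T ⊆ P ∩ N := by
    intro T hT hTP v hv
    obtain ⟨s, hs, hvs⟩ := mem_vertices.1 hv
    obtain ⟨x, hx⟩ := hT.frame s hs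
    exact ⟨hTP hv, hx.mem v hvs⟩
  -- The measure is the number of lattice points of `P` that are not yet vertices.
  induction hn : (P ∩ N).ncard - (vertices T).ncard using Nat.strong_induction_on generalizing T with
  | _ n ih =>
    by_cases hdone : ∀ t ∈ T, ∀ A ⊆ t, 1 < A.card → ∑ a ∈ A, a ∉ P
    · exact ⟨T, hT, hTP, fun t ht => ⟨t, ht, le_rfl⟩, hdone⟩
    · push Not at hdone
      obtain ⟨s, hs, A, hA, hcard, hAP⟩ := hdone
      have hT' := hT.isTriangulation_starSubdivision hs hA hcard
      have hTP' : vertices (starSubdivision T A) ⊆ P :=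
        vertices_starSubdivision_subset.trans (Set.insert_subset hAP hTP)
      have hsub' := hsub _ hT' hTP'
      have hle := Set.ncard_le_ncard hsub' hfin
      have hlt : (vertices T).ncard < (vertices (starSubdivision T A)).ncard := by
        refine Set.ncard_lt_ncard ?_ (hfin.subset hsub')
        have h := subset_vertices_starSubdivision hs hA hcard
        exact (Set.ssubset_insert (hT.sum_notMem_vertices hs hA hcard)).trans_subset h
      obtain ⟨T'', h1, h2, h3, h4⟩ := ih _ (by omega) hT' hTP' rfl
      refine ⟨T'', h1, h2, fun t ht => ?_, h4⟩
      obtain ⟨t', ht', hle'⟩ := h3 t ht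
      obtain ⟨t'', ht'', hle''⟩ := IsTriangulation.starSubdivision_le ht'
      exact ⟨t'', ht'', hle'.trans hle''⟩

/-- A regular unimodular triangulation whose simplices lie in the facets of a reflexive polytope
gives an MPCP subdivision. -/
theorem IsTriangulation.isMPCP [FiniteDimensional ℝ V] {T : Set (Finset V)}
    (hT : IsTriangulation N T) (hP : IsReflexive N P) (hTP : vertices T ⊆ P)
    (hne : ∀ s ∈ T, s.Nonempty)
    (hfacet : ∀ s ∈ T, ∃ ℓ : Module.Dual ℝ V, (∀ z ∈ P, ℓ z ≤ 1) ∧ ∀ a ∈ s, ℓ a = 1) :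
    IsMPCP N P (triangulationFan T) where
  isFan := hT.isFan
  refines := by
    have hle : ∀ σ ∈ triangulationFan T, ∃ τ ∈ faceFan P, σ ≤ τ := by
      rintro σ ⟨s, hs, A, hA, rfl⟩
      obtain ⟨ℓ, hℓ, hℓs⟩ := hfacet s hs
      obtain ⟨a, ha⟩ := hne s hs
      have hsP : ∀ a ∈ s, a ∈ P := fun a ha => hTP (mem_vertices.2 ⟨s, hs, ha⟩)
      refine ⟨_, mem_faceFan_of_form (interior_subset hP.zero_mem_interior) hℓ (hsP a ha)
        (hℓs a ha), Submodule.span_mono fun b hb => ?_⟩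
      exact ⟨hsP b (hA hb), hℓs b (hA hb)⟩
    refine ⟨?_, hle⟩
    -- Completeness of the face fan comes for free: its cones contain those of the triangulation,
    -- which cover the space.
    rw [hT.fanSupport_eq]
    refine (Set.eq_univ_of_forall fun v => ?_).symm
    have hv : v ∈ fanSupport (triangulationFan T) := hT.fanSupport_eq ▸ Set.mem_univ v
    obtain ⟨σ, hσ, hvσ⟩ := Set.mem_iUnion₂.1 hv
    obtain ⟨τ, hτ, hστ⟩ := hle σ hσ
    exact Set.mem_biUnion hτ (hστ hvσ)
  projective := hT.isProjectiveFan
  elementary := by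
    intro σ hσ
    obtain ⟨s, hs, rfl⟩ := exists_of_isMaximalCone hσ
    obtain ⟨x, hx⟩ := hT.frame s hs
    exact hx.isConeOverElementarySimplex
  ray_mem := fun v hv hvF => hP.mem_frontier hv.1 (hTP (hT.mem_vertices_of_coneOver_mem hv hvF))
    hv.2.1

end Facets

end Toric

theorem mainTheorem1 {V : Type*} [NormedAddCommGroup V] [NormedSpace ℝ V]
    (hdim : Module.finrank ℝ V = 3)
    (N : Submodule ℤ V) [DiscreteTopology N] [IsZLattice ℝ N]
    (P₁ P₂ : Set V) (h₁ : Toric.IsReflexive N P₁) (h₂ : Toric.IsReflexive N P₂)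
    (hsub : P₁ ⊆ P₂)
    (F₁ : Set (PointedCone ℝ V)) (hF₁ : Toric.IsMPCP N P₁ F₁) :
    ∃ F₂ : Set (PointedCone ℝ V), Toric.IsMPCP N P₂ F₂ ∧ Toric.Refines F₂ F₁ := by
  have : FiniteDimensional ℝ V := Module.finite_of_finrank_pos (by omega)
  obtain ⟨T₁, hT₁, hTP₁, hTF₁⟩ := hF₁.exists_isTriangulation hdim h₁
  obtain ⟨T, hT, hTP, hTT₁, hsum⟩ :=
    hT₁.exists_refinement h₂.lattice.finite_inter (hTP₁.trans hsub)
  have hcard : ∀ s ∈ T, s.card = 3 := by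
    intro s hs
    obtain ⟨x, hx⟩ := hT.frame s hs
    rw [hx.card_eq, hdim]
  refine ⟨Toric.triangulationFan T, hT.isMPCP h₂ hTP ?_ ?_, ?_, ?_⟩
  · intro s hs
    exact Finset.card_pos.1 (by rw [hcard s hs]; omega)
  · intro s hs
    obtain ⟨x, hx⟩ := hT.frame s hs
    exact h₂.exists_facet hx (hcard s hs)
      (fun a ha => hTP (Toric.mem_vertices.2 ⟨s, hs, ha⟩)) (hsum s hs)
  · rw [hT.fanSupport_eq, hF₁.projective.1]
  · rintro _ ⟨s, hs, A, hA, rfl⟩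
    obtain ⟨t, ht, hle⟩ := hTT₁ s hs
    exact ⟨_, hTF₁ t ht, (Submodule.span_mono (Finset.coe_subset.2 hA)).trans hle⟩
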